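/- Let $n\ge 3$ and let $P$ be a simple lattice polygon in the plane, not necessarily convex: a closed region bounded by a closed polygonal curve with distinct vertices $v_1,\dots,v_n\in\mathbb Z^2$ (in cyclic order), two different edges of which meet at most in common endpoints. Colour every lattice point by the parity of its coordinates, $A=(\text{even},\text{even})$, $B=(\text{odd},\text{even})$, $C=(\text{odd},\text{odd})$, $D=(\text{even},\text{odd})$, and let the boundary word of $P$ be the cyclic word $(X_1X_2\dots X_n)$ in which $X_i$ is the colour of $v_i$. A contracting step on a cyclic word $(X_1\dots X_k)$ with $k\ge 2$ (indices modulo $k$) deletes a letter $X_i$ for which $X_{i-1},X_i,X_{i+1}$ are not all distinct; a cyclic word is contractible if some sequence of contracting steps reduces it to a word with a single letter. If the boundary word of $P$ is not contractible, then $P$ has no dissection into lattice triangles of integer area. That is, $P$ is not the union of finitely many nondegenerate triangles with pairwise disjoint interiors, with vertices in $\mathbb Z^2$, and with integer area. -/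

import Mathlib

/-! The plane is `ℝ × ℝ` and the lattice is `ℤ × ℤ`.  Only the affine structure, the topology and
the bornology of the plane are used, so the choice of a norm on `ℝ × ℝ` plays no role. -/

namespace LatticeDissection

/-- A lattice point, seen as a point of the plane. -/
def toPlane (p : ℤ × ℤ) : ℝ × ℝ := ((p.1 : ℝ), (p.2 : ℝ))

/-! ### Colours and cyclic words -/

/-- The four colours: `(0,0)` is `A`, `(1,0)` is `B`, `(1,1)` is `C`, `(0,1)` is `D`. -/
abbrev Color : Type := ZMod 2 × ZMod 2

/-- The colour of a lattice point: the parities of its two coordinates. -/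
def parity (p : ℤ × ℤ) : Color := ((p.1 : ZMod 2), (p.2 : ZMod 2))

/-- A contracting step on cyclic words of length at least two: delete a letter `x` which,
together with the letter before it and the letter after it (cyclically), does not form a triple of
distinct letters.  The cyclic word is rotated so that `x` comes first; then the letter after `x` is
the first letter of the rest `l`, and the letter before `x` is the last letter of `l`. -/
def ContractingStep {α : Type*} (w w' : Cycle α) : Prop :=
  ∃ (x : α) (l : List α) (hl : l ≠ []),
    w = ((x :: l : List α) : Cycle α) ∧ w' = (l : Cycle α) ∧
      ¬ [l.getLast hl, x, l.head hl].Nodup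

/-- A cyclic word is contractible if some sequence of contracting steps leads from it to a word
with a single letter. -/
def Contractible {α : Type*} (w : Cycle α) : Prop :=
  ∃ x : α, Relation.ReflTransGen ContractingStep w (([x] : List α) : Cycle α)

/-! ### Polygons -/

/-- A closed polygonal curve with at least three vertices is simple if its vertices are distinct
and two different edges meet at most in common endpoints. -/
def IsSimple {n : ℕ} (Q : Polygon (ℝ × ℝ) n) : Prop :=
  3 ≤ n ∧ Function.Injective Q.vertices ∧
    ∀ i j : Fin n, i ≠ j →
      Q.edgeSet ℝ i ∩ Q.edgeSet ℝ j ⊆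
        {Q i, Q (finRotate n i)} ∩ {Q j, Q (finRotate n j)}

/-- The closed region enclosed by a polygonal curve: the curve together with the bounded
connected components of its complement. -/
def region {n : ℕ} (Q : Polygon (ℝ × ℝ) n) : Set (ℝ × ℝ) :=
  Q.boundary ℝ ∪
    {x | x ∉ Q.boundary ℝ ∧ Bornology.IsBounded (connectedComponentIn (Q.boundary ℝ)ᶜ x)}

/-- A polygon with vertices in the lattice, seen as a polygon in the plane. -/
def realize {n : ℕ} (P : Polygon (ℤ × ℤ) n) : Polygon (ℝ × ℝ) n :=
  ⟨fun i => toPlane (P i)⟩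

/-- The boundary word: the colours of the vertices in their cyclic order. -/
def boundaryWord {n : ℕ} (P : Polygon (ℤ × ℤ) n) : Cycle Color :=
  ((List.ofFn fun i => parity (P i) : List Color) : Cycle Color)

/-! ### Triangles and dissections -/

/-- A (nondegenerate) triangle in the plane whose vertices are lattice points. -/
structure LatticeTriangle where
  /-- The three vertices. -/
  vertex : Fin 3 → ℤ × ℤ
  /-- The vertices are not collinear. -/
  nondegenerate : AffineIndependent ℝ fun i => toPlane (vertex i)

/-- The closed triangle. -/
def LatticeTriangle.carrier (t : LatticeTriangle) : Set (ℝ × ℝ) :=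
  convexHull ℝ (Set.range fun i => toPlane (t.vertex i))

/-- The area of a triangle, by the determinant formula. -/
noncomputable def LatticeTriangle.area (t : LatticeTriangle) : ℝ :=
  |(1 / 2 : ℝ) * Matrix.det
    !![1, 1, 1;
       ((t.vertex 0).1 : ℝ), ((t.vertex 1).1 : ℝ), ((t.vertex 2).1 : ℝ);
       ((t.vertex 0).2 : ℝ), ((t.vertex 1).2 : ℝ), ((t.vertex 2).2 : ℝ)]|

/-- A finite family of triangles is a dissection of `R` if `R` is the union of the triangles and
the interiors of different triangles of the family do not overlap. -/
def IsDissection {m : ℕ} (T : Fin m → LatticeTriangle) (R : Set (ℝ × ℝ)) : Prop :=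
  (⋃ i, (T i).carrier) = R ∧
    ∀ i j : Fin m, i ≠ j → Disjoint (interior (T i).carrier) (interior (T j).carrier)

/-- `R` has an integral dissection: one into lattice triangles of integer area. -/
def HasIntegralDissection (R : Set (ℝ × ℝ)) : Prop :=
  ∃ (m : ℕ) (T : Fin m → LatticeTriangle),
    IsDissection T R ∧ ∀ i, ∃ k : ℤ, (T i).area = (k : ℝ)

end LatticeDissection

/-!
A triangle with vertices in the lattice has integer area exactly when two of its vertices have the
same colour.  Cut every side of every triangle at all its lattice points into primitive edges.
Along a side two colours alternate, so on the boundary of a triangle of integer area the edges can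
be matched in pairs of consecutive edges `uv`, `vw` with `u` and `w` of the same colour
(`sum_edges_of_edgeRel`).  Generate an equivalence relation on edges by these matchings, for all
triangles of the dissection.  Geometrically, a class consists of the edges crossed by a curve that
joins matched edges inside the triangles.  Every triangle crosses each class an even number of
times, so the indicator function of a class is a cocycle modulo two.

The first cohomology modulo two of the polygon vanishes
(`IsDissection.sum_edges_eq_zero`): the winding number of a closed walk along the edges is constant
on every open triangle, is zero outside the polygon, and changes across an edge by the number of
passages of the walk along it, modulo two.  Hence the walk is, modulo two, the sum of the
boundaries of the triangles weighted by its winding numbers.  So each class has a potential on the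
vertices, which takes different values at the ends of the edges of this class, and only one value
on the ends of the edges of any other class, as matched edges share a vertex.  In other words, each
class becomes a single bridge in the graph of potentials, which is therefore a forest.  A closed
walk then crosses some class twice in a row (`IsBridgeWalk.exists_adjacent`); these two steps go
back and forth between the same two colours and can be cancelled.  Thus the colour walk of a closed
walk along the edges reduces to a point (`IsDissection.foldl_push_closed`).

It remains to see that the boundary curve of the polygon is such a walk
(`sideEdges_subset_allEdges`).  The sum modulo two of the boundaries of all triangles is a cycle.
An edge belongs to it if and only if exactly one side of the edge is in the polygon, so the cycle is
supported on the boundary curve; it is not zero, and a nonzero cycle supported on a simple closed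
curve is the whole curve.  Finally, the reduced colour walk along a side depends on its two ends
only, and a cyclic word with trivial reduced walk is contractible
(`contractible_of_foldl_push`).

To avoid special positions, an edge is always tested at a point dividing it in an irrational ratio:
a lattice line through such a point contains the whole edge.
-/

open Filter Topology

namespace LatticeDissection

/-! ### Reduced walks and contractible words -/

section Words

variable {α : Type*}

/-- A stored walk is reduced if it has no stationary step and no backtracking. -/
def IsReduced : List α → Prop
  | [] => True
  | [_] => True
  | [a, b] => a ≠ b
  | a :: b :: c :: s => a ≠ b ∧ a ≠ c ∧ IsReduced (b :: c :: s)

theorem IsReduced.tail {a : α} {s : List α} (h : IsReduced (a :: s)) : IsReduced s := by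
  match s, h with
  | [], _ => trivial
  | [_], _ => trivial
  | _ :: _ :: _, h => exact h.2.2

/-- Deleting a letter at any position of a representative of a cyclic word. -/
theorem contractingStep_append {x : α} {a b : List α} (hl : b ++ a ≠ [])
    (h : ¬ [(b ++ a).getLast hl, x, (b ++ a).head hl].Nodup) :
    ContractingStep ((a ++ x :: b : List α) : Cycle α) ((a ++ b : List α) : Cycle α) := by
  refine ⟨x, b ++ a, hl, ?_, ?_, h⟩
  · exact Cycle.coe_eq_coe.2 (by simpa using List.isRotated_append (l := a) (l' := x :: b))
  · exact Cycle.coe_eq_coe.2 List.isRotated_append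

variable [DecidableEq α]

/-- Extend a walk in the complete graph on `α` by one letter and cancel the backtracking so
created.  The walk is stored in reverse, so that its endpoint is the head of the list. -/
def push : List α → α → List α
  | [], x => [x]
  | [y], x => if x = y then [y] else [x, y]
  | y :: z :: s, x => if x = y then y :: z :: s else if x = z then z :: s else x :: y :: z :: s

theorem push_self (s : List α) (x : α) : push (x :: s) x = x :: s := by
  cases s <;> simp [push]

theorem push_back {x y : α} (s : List α) (h : y ≠ x) : push (y :: x :: s) x = x :: s := by
  simp [push, h.symm]

theorem IsReduced.push {s : List α} (h : IsReduced s) (x : α) : IsReduced (push s x) := by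
  match s, h with
  | [], _ => trivial
  | [y], _ =>
    simp only [LatticeDissection.push]
    split_ifs with h1
    · trivial
    · exact h1
  | y :: z :: s, h =>
    simp only [LatticeDissection.push]
    split_ifs with h1 h2
    · exact h
    · exact h.tail
    · exact ⟨h1, h2, h⟩

theorem head?_push (s : List α) (x : α) : (push s x).head? = some x := by
  match s with
  | [] => rfl
  | [y] =>
    simp only [push]
    split_ifs <;> simp_all
  | y :: z :: s =>
    simp only [push]
    split_ifs <;> simp_all

/-- Going to `y` and back to the endpoint `x` of a reduced walk does not change it. -/
theorem push_push_back {x : α} {s : List α} (h : IsReduced (x :: s)) (y : α) :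
    push (push (x :: s) y) x = x :: s := by
  match s, h with
  | [], _ =>
    by_cases h1 : y = x
    · simp [push, h1]
    · simp [push, h1, Ne.symm h1]
  | [z], h =>
    by_cases h1 : y = x
    · subst h1; simp [push_self]
    by_cases h2 : y = z
    · subst h2
      simp [push, h1, Ne.symm h1]
    · simp [push, h1, h2, Ne.symm h1]
  | z :: w :: s, h =>
    by_cases h1 : y = x
    · subst h1; simp [push_self]
    by_cases h2 : y = z
    · subst h2
      simp [push, h1, Ne.symm h1, h.2.1]
    · simp [push, h1, h2, Ne.symm h1]

theorem IsReduced.foldl {s : List α} (h : IsReduced s) (l : List α) :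
    IsReduced (l.foldl LatticeDissection.push s) := by
  induction l generalizing s with
  | nil => exact h
  | cons a l ih => exact ih (h.push a)

/-- A closed word whose reduced walk is constant is contractible.  The part `s` of the word has
already been reduced; it ends, as a stored walk, in the base letter `x`. -/
theorem contractible_of_foldl_push (x : α) (l s : List α)
    (h : (l ++ [x]).foldl push (s ++ [x]) = [x]) :
    Contractible (((s ++ [x]).reverse ++ l : List α) : Cycle α) := by
  induction l generalizing s with
  | nil =>
    match s with
    | [] => exact ⟨x, by simpa using Relation.ReflTransGen.refl⟩
    | [a] =>
      refine ⟨x, Relation.ReflTransGen.single ?_⟩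
      simpa using contractingStep_append (x := a) (a := [x]) (b := []) (by simp) (by simp)
    | a :: b :: s =>
      exfalso
      have : 2 ≤ (push (a :: b :: s ++ [x]) x).length := by
        simp only [push, List.cons_append]
        split_ifs <;> simp
      simp only [List.nil_append, List.foldl_cons, List.foldl_nil] at h
      rw [h] at this
      simp at this
  | cons y l ih =>
    -- three cases: `y` repeats the endpoint, backtracks, or properly extends the walk
    have key1 : ∀ t : List α, ∀ a, s ++ [x] = a :: t → y = a →
        Contractible (((s ++ [x]).reverse ++ y :: l : List α) : Cycle α) := by
      rintro t a hs rfl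
      have h' : (l ++ [x]).foldl push (s ++ [x]) = [x] := by
        rw [List.cons_append, List.foldl_cons, hs, push_self, ← hs] at h
        exact h
      obtain ⟨z, hz⟩ := ih s h'
      refine ⟨z, Relation.ReflTransGen.head ?_ hz⟩
      refine contractingStep_append (by simp) ?_
      simp [hs]
    match s, ih, key1 with
    | [], ih, key1 =>
      by_cases h1 : y = x
      · exact key1 [] x rfl h1
      · have := ih [y] (by simpa [push, h1] using h)
        simpa using this
    | a :: s, ih, key1 =>
      by_cases h1 : y = a
      · exact key1 (s ++ [x]) a rfl h1
      by_cases h2 : (s ++ [x]).head (by simp) = y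
      · obtain ⟨t, ht⟩ : ∃ t, s ++ [x] = y :: t := by
          cases hs : s ++ [x] with
          | nil => simp at hs
          | cons b t => simp only [hs, List.head_cons] at h2; exact ⟨t, by rw [h2]⟩
        have h' : (l ++ [x]).foldl push (s ++ [x]) = [x] := by
          rw [List.cons_append, List.cons_append, List.foldl_cons, ht,
            push_back _ (Ne.symm h1), ← ht] at h
          exact h
        obtain ⟨z, hz⟩ := ih s h'
        refine ⟨z, Relation.ReflTransGen.head (b := (((s ++ [x]).reverse ++ y :: l : List α) :
          Cycle α)) ?_ (Relation.ReflTransGen.head ?_ hz)⟩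
        · have := contractingStep_append (x := a) (a := (s ++ [x]).reverse) (b := y :: l)
            (by simp) (by simp [ht])
          simpa using this
        · refine contractingStep_append (by simp) ?_
          simp [ht]
      · have h3 : push (a :: (s ++ [x])) y = y :: a :: (s ++ [x]) := by
          cases hs : s ++ [x] with
          | nil => simp at hs
          | cons b t =>
            simp only [hs, List.head_cons] at h2
            simp [push, h1, Ne.symm h2]
        have := ih (y :: a :: s) (by simpa [h3] using h)
        simpa using this

end Words

/-! ### Walks whose edge classes are bridges -/

section Bridges

variable {α Λ : Type*}

/-- A sequence of steps `(c, y)`, each crossing an edge of class `c` towards a vertex of colour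
`y`.  A vertex has a potential `σ : Λ → ZMod 2`, which a step of class `c` changes in the
coordinate `c` only; the other coordinates are prescribed by `κ c`, so that `c` is a single edge
in the graph of potentials.  The colours of the two ends of an edge of class `c` are `pair c`. -/
def IsBridgeWalk (κ : Λ → Λ → ZMod 2) (pair : Λ → Sym2 α) :
    (Λ → ZMod 2) → α → List (Λ × α) → (Λ → ZMod 2) → Prop
  | σ, _, [], τ => σ = τ
  | σ, x, (c, y) :: l, τ => pair c = s(x, y) ∧ (∀ b, b ≠ c → σ b = κ c b) ∧
      ∃ σ', σ' c = σ c + 1 ∧ (∀ b, b ≠ c → σ' b = σ b) ∧ IsBridgeWalk κ pair σ' y l τ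

variable {κ : Λ → Λ → ZMod 2} {pair : Λ → Sym2 α}

/-- If a coordinate of the potential changes along the walk, then its class is crossed. -/
theorem IsBridgeWalk.exists_mem {σ τ : Λ → ZMod 2} {x : α} {l : List (Λ × α)}
    (h : IsBridgeWalk κ pair σ x l τ) {b : Λ} (hb : σ b ≠ τ b) :
    ∃ l₁ y l₂, l = l₁ ++ (b, y) :: l₂ := by
  induction l generalizing σ x with
  | nil => exact absurd (congrFun h b) hb
  | cons p l ih =>
    obtain ⟨c, y⟩ := p
    obtain ⟨-, -, σ', -, h2, h3⟩ := h
    by_cases hc : b = c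
    · subst hc; exact ⟨[], y, l, rfl⟩
    · obtain ⟨l₁, z, l₂, rfl⟩ := ih h3 (by rwa [h2 b hc])
      exact ⟨(c, y) :: l₁, z, l₂, rfl⟩

theorem IsBridgeWalk.split {σ τ : Λ → ZMod 2} {x : α} {l₁ l₂ : List (Λ × α)}
    (h : IsBridgeWalk κ pair σ x (l₁ ++ l₂) τ) :
    ∃ σ' y, IsBridgeWalk κ pair σ x l₁ σ' ∧ IsBridgeWalk κ pair σ' y l₂ τ := by
  induction l₁ generalizing σ x with
  | nil => exact ⟨σ, x, rfl, h⟩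
  | cons p l ih =>
    obtain ⟨c, y⟩ := p
    obtain ⟨h0, h1, σ', h4, h2, h3⟩ := h
    obtain ⟨ρ, z, h5, h6⟩ := ih h3
    exact ⟨ρ, z, ⟨h0, h1, σ', h4, h2, h5⟩, h6⟩

/-- Between two crossings of a class there are two consecutive crossings of one class: every other
class met in between is met twice, because the potential agrees there at both crossings. -/
theorem IsBridgeWalk.exists_adjacent {σ τ : Λ → ZMod 2} {x : α} {c : Λ} {y z : α}
    {l l' : List (Λ × α)} (h : IsBridgeWalk κ pair σ x ((c, y) :: (l ++ (c, z) :: l')) τ) :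
    ∃ l₁ b u v l₂, (c, y) :: (l ++ (c, z) :: l') = l₁ ++ (b, u) :: (b, v) :: l₂ := by
  induction hn : l.length using Nat.strong_induction_on generalizing σ x c y z l l' with
  | _ n ih =>
    match l with
    | [] => exact ⟨[], c, y, z, l', rfl⟩
    | (b, w) :: m =>
      by_cases hb : b = c
      · subst hb; exact ⟨[], b, y, w, m ++ (b, z) :: l', rfl⟩
      · obtain ⟨-, h1, σ₁, -, h2, h3⟩ := h
        have h3' := h3
        obtain ⟨-, -, σ₂, h4, -, h5⟩ := h3
        obtain ⟨σ₃, t, h6, h7⟩ := h5.split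
        obtain ⟨-, h8, -⟩ := h7
        -- `σ₂` is the potential after the step `b`, and `σ₃` the one before the second step `c`
        have hne : σ₂ b ≠ σ₃ b := by
          rw [h8 b hb, h4, h2 b hb, h1 b hb]
          simp
        obtain ⟨m₁, u, m₂, rfl⟩ := h6.exists_mem hne
        have h9 : IsBridgeWalk κ pair σ₁ y
            ((b, w) :: (m₁ ++ (b, u) :: (m₂ ++ (c, z) :: l'))) τ := by
          simpa using h3'
        obtain ⟨l₁, d, p, q, l₂, he⟩ := ih m₁.length (by simp at hn; omega) h9 rfl
        refine ⟨(c, y) :: l₁, d, p, q, l₂, ?_⟩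
        simp only [List.cons_append, List.append_assoc] at he ⊢
        rw [he]

/-- Two consecutive crossings of one class return to the same colour and potential. -/
theorem IsBridgeWalk.cancel {σ τ : Λ → ZMod 2} {x : α} {l₁ l₂ : List (Λ × α)} {b : Λ} {u v : α}
    (h : IsBridgeWalk κ pair σ x (l₁ ++ (b, u) :: (b, v) :: l₂) τ) :
    IsBridgeWalk κ pair σ x (l₁ ++ l₂) τ ∧ ((l₁.map Prod.snd).getLast?.getD x) = v := by
  induction l₁ generalizing σ x with
  | nil =>
    obtain ⟨h0, -, σ', h1, h2, h3, -, σ'', h4, h5, h6⟩ := h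
    have hv : v = x := by
      rw [h0, Sym2.eq_iff] at h3
      grind
    have hs : σ'' = σ := by
      funext d
      by_cases hd : d = b
      · subst hd
        rw [h4, h1, add_assoc]
        have : (1 + 1 : ZMod 2) = 0 := by decide
        rw [this, add_zero]
      · rw [h5 d hd, h2 d hd]
    subst hv hs
    exact ⟨h6, rfl⟩
  | cons p l ih =>
    obtain ⟨c, y⟩ := p
    obtain ⟨h0, h1, σ', h4, h2, h3⟩ := h
    obtain ⟨h5, h6⟩ := ih h3
    refine ⟨⟨h0, h1, σ', h4, h2, h5⟩, ?_⟩
    rw [← h6, List.map_cons, List.getLast?_cons]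
    simp

/-- The endpoint of a stored walk after pushing a list of letters. -/
theorem exists_foldl_push_eq_cons [DecidableEq α] (x : α) (s l : List α) :
    ∃ t, l.foldl push (x :: s) = l.getLast?.getD x :: t := by
  induction l using List.reverseRecOn with
  | nil => exact ⟨s, rfl⟩
  | append_singleton l a _ =>
    obtain ⟨t, ht⟩ := List.head?_eq_some_iff.1 (head?_push (l.foldl push (x :: s)) a)
    exact ⟨t, by simpa [List.foldl_append] using ht⟩

/-- A walk with closed potential does not change the reduced colour walk. -/
theorem IsBridgeWalk.foldl_push [DecidableEq α] {σ : Λ → ZMod 2} {x : α} {l : List (Λ × α)}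
    (h : IsBridgeWalk κ pair σ x l σ) {s : List α} (hs : IsReduced (x :: s)) :
    (l.map Prod.snd).foldl push (x :: s) = x :: s := by
  induction hn : l.length using Nat.strong_induction_on generalizing l with
  | _ n ih =>
    match l with
    | [] => rfl
    | (c, y) :: m =>
      have h' := h
      obtain ⟨-, -, σ', h1, -, h3⟩ := h'
      obtain ⟨m₁, z, m₂, rfl⟩ := h3.exists_mem (b := c) (by rw [h1]; simp)
      obtain ⟨l₁, b, u, v, l₂, he⟩ := h.exists_adjacent
      rw [he] at h hn ⊢
      obtain ⟨h4, h5⟩ := h.cancel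
      have := ih (l₁ ++ l₂).length (by simp at hn ⊢; omega) h4 rfl
      refine Eq.trans ?_ this
      simp only [List.map_append, List.map_cons, List.foldl_append, List.foldl_cons]
      congr 1
      have hr : IsReduced ((l₁.map Prod.snd).foldl push (x :: s)) := hs.foldl _
      obtain ⟨t, ht⟩ := exists_foldl_push_eq_cons x s (l₁.map Prod.snd)
      rw [h5] at ht
      rw [ht] at hr ⊢
      exact push_push_back hr u

end Bridges

/-! ### Potentials on graphs -/

/-- An edge function with zero sum over all closed walks is the coboundary of a potential. -/
theorem exists_potential {V : Type*} (G : SimpleGraph V) (f : Sym2 V → ZMod 2)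
    (hf : ∀ (u : V) (w : G.Walk u u), (w.edges.map f).sum = 0) :
    ∃ s : V → ZMod 2, ∀ u v, G.Adj u v → s v = s u + f s(u, v) := by
  classical
  have hr : ∀ v, G.Reachable (G.connectedComponentMk v).out v := fun v =>
    SimpleGraph.ConnectedComponent.exact (Quot.out_eq (G.connectedComponentMk v))
  refine ⟨fun v => (((hr v).some).edges.map f).sum, fun u v huv => ?_⟩
  have hc : (G.connectedComponentMk u).out = (G.connectedComponentMk v).out := by
    rw [SimpleGraph.ConnectedComponent.connectedComponentMk_eq_of_adj huv]
  have key : ∀ (a b : V) (_ : a = b) (p : G.Walk a u) (q : G.Walk b v),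
      (q.edges.map f).sum = (p.edges.map f).sum + f s(u, v) := by
    rintro a _ rfl p q
    have := hf a ((p.concat huv).append q.reverse)
    simp only [SimpleGraph.Walk.edges_append, SimpleGraph.Walk.edges_concat,
      SimpleGraph.Walk.edges_reverse, List.map_append, List.sum_append, List.map_reverse,
      List.sum_reverse, List.concat_eq_append, List.map_cons, List.map_nil, List.sum_cons,
      List.sum_nil, add_zero] at this
    exact (CharTwo.add_eq_zero.1 this).symm
  exact key _ _ hc _ _

/-! ### Primitive edges of lattice segments -/

/-- The lattice length of the segment from `p` to `q`. -/
def sideLen (p q : ℤ × ℤ) : ℕ := Int.gcd (q.1 - p.1) (q.2 - p.2)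

/-- The primitive vector in the direction from `p` to `q` (zero if `p = q`). -/
def sideDir (p q : ℤ × ℤ) : ℤ × ℤ :=
  ((q.1 - p.1) / (sideLen p q : ℤ), (q.2 - p.2) / (sideLen p q : ℤ))

/-- The lattice points of the segment from `p` to `q` are `sidePt p q k` for `k ≤ sideLen p q`. -/
def sidePt (p q : ℤ × ℤ) (k : ℕ) : ℤ × ℤ :=
  (p.1 + k * (sideDir p q).1, p.2 + k * (sideDir p q).2)

/-- The primitive edges into which its lattice points divide the segment from `p` to `q`. -/
def sideEdge (p q : ℤ × ℤ) (k : ℕ) : Sym2 (ℤ × ℤ) := s(sidePt p q k, sidePt p q (k + 1))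

/-- The list of all primitive edges of the segment from `p` to `q`. -/
def sideEdges (p q : ℤ × ℤ) : List (Sym2 (ℤ × ℤ)) :=
  (List.range (sideLen p q)).map (sideEdge p q)

theorem sideLen_pos {p q : ℤ × ℤ} (h : p ≠ q) : 0 < sideLen p q := by
  apply Int.gcd_pos_iff.2
  by_contra! hc
  exact h (Prod.ext (by omega) (by omega))

theorem sideLen_mul_fst (p q : ℤ × ℤ) : (sideLen p q : ℤ) * (sideDir p q).1 = q.1 - p.1 :=
  Int.mul_ediv_cancel' (Int.gcd_dvd_left ..)

theorem sideLen_mul_snd (p q : ℤ × ℤ) : (sideLen p q : ℤ) * (sideDir p q).2 = q.2 - p.2 :=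
  Int.mul_ediv_cancel' (Int.gcd_dvd_right ..)

theorem isCoprime_sideDir {p q : ℤ × ℤ} (h : p ≠ q) :
    IsCoprime (sideDir p q).1 (sideDir p q).2 :=
  Int.isCoprime_iff_gcd_eq_one.2 (Int.gcd_ediv_gcd_ediv_gcd (sideLen_pos h))

theorem sidePt_zero (p q : ℤ × ℤ) : sidePt p q 0 = p := by simp [sidePt]

theorem sidePt_sideLen (p q : ℤ × ℤ) : sidePt p q (sideLen p q) = q := by
  simp [sidePt, sideLen_mul_fst, sideLen_mul_snd]

theorem sideDir_ne_zero {p q : ℤ × ℤ} (h : p ≠ q) :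
    (sideDir p q).1 ≠ 0 ∨ (sideDir p q).2 ≠ 0 := by
  by_contra! hc
  have := isCoprime_sideDir h
  rw [hc.1, hc.2] at this
  exact not_isCoprime_zero_zero this

theorem sidePt_injective {p q : ℤ × ℤ} (h : p ≠ q) : Function.Injective (sidePt p q) := by
  intro k l hkl
  simp only [sidePt, Prod.mk.injEq, add_right_inj, mul_eq_mul_right_iff, Nat.cast_inj] at hkl
  rcases sideDir_ne_zero h with h1 | h1
  · exact hkl.1.resolve_right h1
  · exact hkl.2.resolve_right h1

theorem sideEdge_injective {p q : ℤ × ℤ} (h : p ≠ q) : Function.Injective (sideEdge p q) := by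
  intro k l hkl
  have hi := sidePt_injective h
  simp only [sideEdge, Sym2.eq_iff] at hkl
  rcases hkl with ⟨h1, -⟩ | ⟨h1, h2⟩
  · exact hi h1
  · have := hi h1; have := hi h2; omega

theorem nodup_sideEdges {p q : ℤ × ℤ} (h : p ≠ q) : (sideEdges p q).Nodup :=
  List.Nodup.map (sideEdge_injective h) List.nodup_range

theorem mem_sideEdges {p q : ℤ × ℤ} {e : Sym2 (ℤ × ℤ)} :
    e ∈ sideEdges p q ↔ ∃ k < sideLen p q, sideEdge p q k = e := by
  simp [sideEdges]

/-- Two lattice points whose difference is a primitive vector. -/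
def PrimAdj (u w : ℤ × ℤ) : Prop := IsCoprime (w.1 - u.1) (w.2 - u.2)

theorem PrimAdj.symm {u w : ℤ × ℤ} (h : PrimAdj u w) : PrimAdj w u := by
  have := h.neg_neg
  simpa [PrimAdj] using this

theorem PrimAdj.ne {u w : ℤ × ℤ} (h : PrimAdj u w) : u ≠ w := by
  rintro rfl
  rw [PrimAdj, sub_self, sub_self] at h
  exact not_isCoprime_zero_zero h

theorem primAdj_sidePt {p q : ℤ × ℤ} (h : p ≠ q) (k : ℕ) :
    PrimAdj (sidePt p q k) (sidePt p q (k + 1)) := by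
  have := isCoprime_sideDir h
  unfold PrimAdj sidePt
  convert this using 1 <;> push_cast <;> ring

theorem primAdj_of_mem_sideEdges {p q u w : ℤ × ℤ} (h : p ≠ q) (he : s(u, w) ∈ sideEdges p q) :
    PrimAdj u w := by
  obtain ⟨k, -, hk⟩ := mem_sideEdges.1 he
  rw [sideEdge, Sym2.eq_iff] at hk
  rcases hk with ⟨rfl, rfl⟩ | ⟨rfl, rfl⟩
  · exact primAdj_sidePt h k
  · exact (primAdj_sidePt h k).symm

/-- The point with parameter `t` on the line through the lattice points `u` and `w`. -/
noncomputable def edgePt (u w : ℤ × ℤ) (t : ℝ) : ℝ × ℝ :=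
  (u.1 + t * (w.1 - u.1), u.2 + t * (w.2 - u.2))

theorem edgePt_swap (u w : ℤ × ℤ) (t : ℝ) : edgePt w u (1 - t) = edgePt u w t := by
  simp only [edgePt, Prod.mk.injEq]
  constructor <;> ring

theorem mem_segment_iff_edgePt {p q : ℤ × ℤ} {x : ℝ × ℝ} :
    x ∈ segment ℝ (toPlane p) (toPlane q) ↔ ∃ r : ℝ, 0 ≤ r ∧ r ≤ 1 ∧ edgePt p q r = x := by
  rw [segment_eq_image']
  simp only [Set.mem_image, Set.mem_Icc, and_assoc]
  refine exists_congr fun r => and_congr_right fun _ => and_congr_right fun _ => ?_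
  have : toPlane p + r • (toPlane q - toPlane p) = edgePt p q r := by
    simp [toPlane, edgePt]
  rw [this]

/-- The same parametrization by lattice length. -/
theorem mem_segment_iff_sideDir {p q : ℤ × ℤ} (h : p ≠ q) {x : ℝ × ℝ} :
    x ∈ segment ℝ (toPlane p) (toPlane q) ↔ ∃ r : ℝ, 0 ≤ r ∧ r ≤ sideLen p q ∧
      x = (p.1 + r * (sideDir p q).1, p.2 + r * (sideDir p q).2) := by
  have hL : (0 : ℝ) < sideLen p q := by exact_mod_cast sideLen_pos h
  have h1 : (sideLen p q : ℝ) * (sideDir p q).1 = q.1 - p.1 := by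
    exact_mod_cast sideLen_mul_fst p q
  have h2 : (sideLen p q : ℝ) * (sideDir p q).2 = q.2 - p.2 := by
    exact_mod_cast sideLen_mul_snd p q
  rw [mem_segment_iff_edgePt]
  constructor
  · rintro ⟨r, h3, h4, rfl⟩
    refine ⟨r * sideLen p q, by positivity, by nlinarith, ?_⟩
    rw [edgePt, ← h1, ← h2]
    simp only [Prod.mk.injEq]
    constructor <;> ring
  · rintro ⟨r, h3, h4, rfl⟩
    refine ⟨r / sideLen p q, by positivity, (div_le_one hL).2 h4, ?_⟩
    rw [edgePt, ← h1, ← h2]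
    simp only [Prod.mk.injEq]
    constructor <;> field_simp

theorem toPlane_sidePt_mem {p q : ℤ × ℤ} (h : p ≠ q) {k : ℕ} (hk : k ≤ sideLen p q) :
    toPlane (sidePt p q k) ∈ segment ℝ (toPlane p) (toPlane q) := by
  rw [mem_segment_iff_sideDir h]
  exact ⟨k, by positivity, by exact_mod_cast hk, by simp [toPlane, sidePt]⟩

theorem toPlane_injective : Function.Injective toPlane := by
  intro p q h
  simp only [toPlane, Prod.mk.injEq, Int.cast_inj] at h
  exact Prod.ext h.1 h.2

theorem segment_subset_of_mem_sideEdges {p q u w : ℤ × ℤ} (h : p ≠ q)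
    (he : s(u, w) ∈ sideEdges p q) :
    segment ℝ (toPlane u) (toPlane w) ⊆ segment ℝ (toPlane p) (toPlane q) := by
  obtain ⟨k, hk, hk'⟩ := mem_sideEdges.1 he
  have h1 := toPlane_sidePt_mem h hk.le
  have h2 := toPlane_sidePt_mem h (Nat.succ_le_of_lt hk)
  rw [sideEdge, Sym2.eq_iff] at hk'
  rcases hk' with ⟨rfl, rfl⟩ | ⟨rfl, rfl⟩
  · exact (convex_segment _ _).segment_subset h1 h2
  · exact (convex_segment _ _).segment_subset h2 h1

/-- A rational line through a point of irrational parameter contains the whole lattice line. -/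
theorem int_line_of_irrational {t : ℝ} (ht : Irrational t) {a b : ℤ}
    (h : (a : ℝ) + t * b = 0) : a = 0 ∧ b = 0 := by
  have hb : b = 0 := by
    by_contra hb
    have hb' : (b : ℝ) ≠ 0 := by exact_mod_cast hb
    apply ht
    refine ⟨-(a : ℚ) / b, ?_⟩
    push_cast
    field_simp
    linarith
  subst hb
  simpa using h

theorem exists_mul_of_isCoprime {a b x y : ℤ} (h : IsCoprime a b) (hxy : a * y = b * x) :
    ∃ k, x = k * a ∧ y = k * b := by
  obtain ⟨m, n, hmn⟩ := h
  refine ⟨m * x + n * y, ?_, ?_⟩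
  · linear_combination (-x) * hmn - n * hxy
  · linear_combination (-y) * hmn + m * hxy

theorem edgePt_mem_segment_iff {u w p q : ℤ × ℤ} (huw : PrimAdj u w) (h : p ≠ q) {t : ℝ}
    (ht : Irrational t) (h0 : 0 < t) (h1 : t < 1) :
    edgePt u w t ∈ segment ℝ (toPlane p) (toPlane q) ↔ s(u, w) ∈ sideEdges p q := by
  constructor
  · intro hx
    obtain ⟨r, hr0, hr1, hr⟩ := (mem_segment_iff_sideDir h).1 hx
    simp only [edgePt, Prod.mk.injEq] at hr
    obtain ⟨hra, hrb⟩ := hr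
    set d := sideDir p q with hd
    have key : (((u.2 - p.2) * d.1 - (u.1 - p.1) * d.2 : ℤ) : ℝ) +
        t * (((w.2 - u.2) * d.1 - (w.1 - u.1) * d.2 : ℤ) : ℝ) = 0 := by
      push_cast
      linear_combination (d.1 : ℝ) * hrb - (d.2 : ℝ) * hra
    obtain ⟨k1, k2⟩ := int_line_of_irrational ht key
    obtain ⟨i, hi1, hi2⟩ := exists_mul_of_isCoprime (isCoprime_sideDir h)
      (x := u.1 - p.1) (y := u.2 - p.2) (by rw [← hd]; linarith)
    obtain ⟨j, hj1, hj2⟩ := exists_mul_of_isCoprime (isCoprime_sideDir h)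
      (x := w.1 - u.1) (y := w.2 - u.2) (by rw [← hd]; linarith)
    rw [← hd] at hi1 hi2 hj1 hj2
    have hj : IsUnit j := by
      have := huw
      rw [PrimAdj, hj1, hj2] at this
      exact this.isUnit_of_dvd' (Dvd.intro _ rfl) (Dvd.intro _ rfl)
    have hu1 : (u.1 : ℝ) - p.1 = i * d.1 := by exact_mod_cast hi1
    have hu2 : (u.2 : ℝ) - p.2 = i * d.2 := by exact_mod_cast hi2
    have hw1 : (w.1 : ℝ) - u.1 = j * d.1 := by exact_mod_cast hj1
    have hw2 : (w.2 : ℝ) - u.2 = j * d.2 := by exact_mod_cast hj2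
    have hrr : r = i + t * j := by
      rcases sideDir_ne_zero h with hne | hne
      · have hne' : (d.1 : ℝ) ≠ 0 := by exact_mod_cast hne
        apply mul_right_cancel₀ hne'
        linear_combination -hra + hu1 + t * hw1
      · have hne' : (d.2 : ℝ) ≠ 0 := by exact_mod_cast hne
        apply mul_right_cancel₀ hne'
        linear_combination -hrb + hu2 + t * hw2
    subst hrr
    rcases Int.isUnit_iff.1 hj with rfl | rfl
    · have a1 : -1 < i := by
        have : (-1 : ℝ) < i := by push_cast at hr0; linarith
        exact_mod_cast this
      have a2 : i < sideLen p q := by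
        have : (i : ℝ) < sideLen p q := by push_cast at hr1; linarith
        exact_mod_cast this
      lift i to ℕ using by omega
      refine mem_sideEdges.2 ⟨i, by omega, ?_⟩
      rw [sideEdge, Sym2.eq_iff]
      left
      constructor <;> apply Prod.ext <;> simp only [sidePt] <;> push_cast <;> rw [← hd] <;>
        linarith
    · have a1 : 0 < i := by
        have : (0 : ℝ) < i := by push_cast at hr0; linarith
        exact_mod_cast this
      have a2 : i < sideLen p q + 1 := by
        have : (i : ℝ) < sideLen p q + 1 := by push_cast at hr1; linarith
        exact_mod_cast this
      obtain ⟨k, rfl⟩ : ∃ k : ℕ, i = k + 1 := ⟨(i - 1).toNat, by omega⟩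
      refine mem_sideEdges.2 ⟨k, by omega, ?_⟩
      rw [sideEdge, Sym2.eq_iff]
      right
      constructor <;> apply Prod.ext <;> simp only [sidePt] <;> push_cast <;> rw [← hd] <;>
        linarith
  · intro he
    exact segment_subset_of_mem_sideEdges h he
      (mem_segment_iff_edgePt.2 ⟨t, h0.le, h1.le, rfl⟩)

/-- Every point of a lattice segment with irrational abscissa is an irrational point of one of
its primitive edges. -/
theorem exists_edgePt_of_irrational {p q : ℤ × ℤ} (h : p ≠ q) {x : ℝ × ℝ}
    (hx : x ∈ segment ℝ (toPlane p) (toPlane q)) (hirr : Irrational x.1) :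
    ∃ u w t, s(u, w) ∈ sideEdges p q ∧ Irrational t ∧ 0 < t ∧ t < 1 ∧ x = edgePt u w t ∧
      u.1 ≠ w.1 := by
  obtain ⟨r, h0, h1, rfl⟩ := (mem_segment_iff_sideDir h).1 hx
  simp only at hirr
  set d := sideDir p q with hd
  have hd1 : d.1 ≠ 0 := by
    intro hz
    rw [hz] at hirr
    simp at hirr
  have hr : Irrational r := by
    rintro ⟨s, rfl⟩
    apply hirr
    exact ⟨p.1 + s * d.1, by push_cast; rfl⟩
  have hk : (⌊r⌋₊ : ℝ) ≤ r := Nat.floor_le h0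
  have hk' : r < ⌊r⌋₊ + 1 := Nat.lt_floor_add_one r
  have hti : Irrational (r - (⌊r⌋₊ : ℝ)) := hr.sub_natCast _
  refine ⟨sidePt p q ⌊r⌋₊, sidePt p q (⌊r⌋₊ + 1), r - ⌊r⌋₊, mem_sideEdges.2 ⟨_, ?_, rfl⟩,
    hti, lt_of_le_of_ne (by linarith) ?_, by linarith, ?_, ?_⟩
  · have : (⌊r⌋₊ : ℝ) ≤ sideLen p q := hk.trans h1
    have h2 : ⌊r⌋₊ ≤ sideLen p q := by exact_mod_cast this
    refine lt_of_le_of_ne h2 fun hc => hr ⟨sideLen p q, ?_⟩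
    push_cast
    rw [← hc] at h1 ⊢
    linarith
  · intro hc
    rw [← hc] at hti
    simp at hti
  · simp only [edgePt, sidePt, ← hd, Prod.mk.injEq]
    push_cast
    constructor <;> ring
  · simp only [sidePt, ← hd]
    push_cast
    intro hc
    apply hd1
    linarith

/-- A lattice point is not an irrational point of a primitive edge. -/
theorem edgePt_ne_toPlane {u w : ℤ × ℤ} (huw : PrimAdj u w) {t : ℝ} (ht : Irrational t)
    (v : ℤ × ℤ) : edgePt u w t ≠ toPlane v := by
  intro hc
  simp only [edgePt, toPlane, Prod.mk.injEq] at hc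
  have e1 := int_line_of_irrational ht (a := u.1 - v.1) (b := w.1 - u.1)
    (by push_cast; linarith [hc.1])
  have e2 := int_line_of_irrational ht (a := u.2 - v.2) (b := w.2 - u.2)
    (by push_cast; linarith [hc.2])
  rw [PrimAdj, e1.2, e2.2] at huw
  exact not_isCoprime_zero_zero huw

theorem irrational_sqrt_two_sub_one : Irrational (√2 - 1) := by
  simpa using irrational_sqrt_two.sub_natCast 1

theorem sqrt_two_sub_one_pos : 0 < √2 - 1 := by
  have : 1 < √2 := Real.lt_sqrt_of_sq_lt (by norm_num)
  linarith

theorem sqrt_two_sub_one_lt : √2 - 1 < 1 := by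
  have : √2 < 2 := (Real.sqrt_lt' (by norm_num)).2 (by norm_num)
  linarith

/-- The sum of a coboundary over a lattice segment. -/
theorem sum_sideEdges_coboundary (p q : ℤ × ℤ) (f : Sym2 (ℤ × ℤ) → ZMod 2)
    (h : ℤ × ℤ → ZMod 2) (hf : ∀ u v, f s(u, v) = h u + h v) :
    ((sideEdges p q).map f).sum = h p + h q := by
  have : ∀ k, (((List.range k).map (sideEdge p q)).map f).sum = h p + h (sidePt p q k) := by
    intro k
    induction k with
    | zero => simp [sidePt_zero, CharTwo.add_self_eq_zero]
    | succ k ih =>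
      rw [List.range_succ, List.map_append, List.map_append, List.sum_append, ih]
      simp only [List.map_cons, List.map_nil, List.sum_cons, List.sum_nil, add_zero, sideEdge, hf]
      rw [add_assoc, CharTwo.add_cancel_left]
  rw [sideEdges, this, sidePt_sideLen]

/-! ### Lattice triangles -/

namespace LatticeTriangle

variable (T : LatticeTriangle)

/-- Twice the signed area. -/
def det : ℤ :=
  ((T.vertex 1).1 - (T.vertex 0).1) * ((T.vertex 2).2 - (T.vertex 0).2) -
    ((T.vertex 1).2 - (T.vertex 0).2) * ((T.vertex 2).1 - (T.vertex 0).1)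

/-- The linear part of the `i`-th barycentric coordinate. -/
noncomputable def baryLin (i : Fin 3) (n : ℝ × ℝ) : ℝ :=
  (((T.vertex (i + 2)).1 - (T.vertex (i + 1)).1) * n.2 -
    ((T.vertex (i + 2)).2 - (T.vertex (i + 1)).2) * n.1) / T.det

/-- The `i`-th barycentric coordinate. -/
noncomputable def bary (i : Fin 3) (x : ℝ × ℝ) : ℝ :=
  T.baryLin i (x - toPlane (T.vertex (i + 1)))

/-- The open triangle. -/
def openTri : Set (ℝ × ℝ) := {x | ∀ i, 0 < T.bary i x}

/-- The primitive edges on the boundary. -/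
def edges : List (Sym2 (ℤ × ℤ)) :=
  sideEdges (T.vertex 1) (T.vertex 2) ++ sideEdges (T.vertex 2) (T.vertex 0) ++
    sideEdges (T.vertex 0) (T.vertex 1)

theorem vertex_injective : Function.Injective T.vertex := fun _ _ h =>
  T.nondegenerate.injective (congrArg toPlane h)

theorem det_ne_zero : T.det ≠ 0 := by
  intro h
  have hn := T.nondegenerate
  rw [affineIndependent_iff_not_collinear] at hn
  apply hn
  have h01 : T.vertex 0 ≠ T.vertex 1 := fun h => by simpa using T.vertex_injective h
  have h' : ((T.vertex 1).1 - (T.vertex 0).1 : ℝ) * ((T.vertex 2).2 - (T.vertex 0).2) -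
    ((T.vertex 1).2 - (T.vertex 0).2) * ((T.vertex 2).1 - (T.vertex 0).1) = 0 := by
    exact_mod_cast h
  have hmem : toPlane (T.vertex 0) ∈ Set.range fun i => toPlane (T.vertex i) := ⟨0, rfl⟩
  rw [collinear_iff_of_mem hmem]
  refine ⟨toPlane (T.vertex 1) - toPlane (T.vertex 0), ?_⟩
  rintro _ ⟨i, rfl⟩
  fin_cases i
  · exact ⟨0, by simp⟩
  · exact ⟨1, by simp⟩
  · by_cases hd : (T.vertex 1).1 = (T.vertex 0).1
    · have hd2 : ((T.vertex 1).2 : ℝ) - (T.vertex 0).2 ≠ 0 := by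
        intro hc
        apply h01
        refine Prod.ext hd.symm ?_
        have : ((T.vertex 1).2 : ℝ) = (T.vertex 0).2 := by linarith
        exact_mod_cast this.symm
      rw [hd, sub_self, zero_mul, zero_sub, neg_eq_zero, mul_eq_zero] at h'
      have h2 := h'.resolve_left hd2
      refine ⟨((T.vertex 2).2 - (T.vertex 0).2) / ((T.vertex 1).2 - (T.vertex 0).2), ?_⟩
      apply Prod.ext
      · have h3 : (T.vertex 2).1 = (T.vertex 0).1 := by exact_mod_cast sub_eq_zero.1 h2
        simp [toPlane, hd, h3]
      · simp [toPlane]; field_simp; ring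
    · have hd2 : ((T.vertex 1).1 : ℝ) - (T.vertex 0).1 ≠ 0 := by
        intro hc
        apply hd
        have : ((T.vertex 1).1 : ℝ) = (T.vertex 0).1 := by linarith
        exact_mod_cast this
      refine ⟨((T.vertex 2).1 - (T.vertex 0).1) / ((T.vertex 1).1 - (T.vertex 0).1), ?_⟩
      apply Prod.ext
      · simp [toPlane]; field_simp; ring
      · simp [toPlane]; field_simp; linarith

theorem cast_det_ne_zero : (T.det : ℝ) ≠ 0 := by exact_mod_cast T.det_ne_zero

theorem cast_det : (T.det : ℝ) =
    ((T.vertex 1).1 - (T.vertex 0).1) * ((T.vertex 2).2 - (T.vertex 0).2) -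
    ((T.vertex 1).2 - (T.vertex 0).2) * ((T.vertex 2).1 - (T.vertex 0).1) := by
  simp [det]

theorem sum_bary (x : ℝ × ℝ) : T.bary 0 x + T.bary 1 x + T.bary 2 x = 1 := by
  have h := T.cast_det_ne_zero
  simp only [bary, baryLin, toPlane, ← add_div, Fin.isValue, Fin.reduceAdd, Prod.fst_sub,
    Prod.snd_sub]
  rw [div_eq_one_iff_eq h, cast_det]
  ring

theorem eq_sum_bary (x : ℝ × ℝ) : x = T.bary 0 x • toPlane (T.vertex 0) +
    T.bary 1 x • toPlane (T.vertex 1) + T.bary 2 x • toPlane (T.vertex 2) := by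
  have h := T.cast_det_ne_zero
  apply Prod.ext
  · simp only [bary, baryLin, toPlane, Fin.isValue, Fin.reduceAdd, Prod.fst_sub,
      Prod.snd_sub, Prod.fst_add, Prod.smul_mk, smul_eq_mul]
    field_simp
    rw [cast_det]
    ring
  · simp only [bary, baryLin, toPlane, Fin.isValue, Fin.reduceAdd, Prod.fst_sub,
      Prod.snd_sub, Prod.snd_add, Prod.smul_mk, smul_eq_mul]
    field_simp
    rw [cast_det]
    ring

theorem bary_add_smul (i : Fin 3) (x n : ℝ × ℝ) (r : ℝ) :
    T.bary i (x + r • n) = T.bary i x + r * T.baryLin i n := by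
  simp only [bary, baryLin, Prod.fst_sub, Prod.snd_sub, Prod.fst_add, Prod.snd_add, Prod.smul_fst,
    Prod.smul_snd, smul_eq_mul]
  ring

theorem bary_combo (i : Fin 3) (x y : ℝ × ℝ) {r s : ℝ} (h : r + s = 1) :
    T.bary i (r • x + s • y) = r * T.bary i x + s * T.bary i y := by
  obtain rfl : s = 1 - r := by linarith
  simp only [bary, baryLin, Prod.fst_sub, Prod.snd_sub, Prod.fst_add, Prod.snd_add, Prod.smul_fst,
    Prod.smul_snd, smul_eq_mul]
  ring

theorem continuous_bary (i : Fin 3) : Continuous (T.bary i) := by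
  unfold bary baryLin
  fun_prop

theorem bary_self (i : Fin 3) : T.bary i (toPlane (T.vertex i)) = 1 := by
  have h := T.cast_det_ne_zero
  have hd := T.cast_det
  fin_cases i <;> simp only [bary, baryLin, toPlane, Fin.zero_eta, Fin.mk_one, Fin.reduceFinMk,
    Fin.isValue, Fin.reduceAdd, Prod.mk_sub_mk, zero_add] <;> rw [div_eq_one_iff_eq h, hd] <;> ring

theorem bary_add_one (i : Fin 3) : T.bary i (toPlane (T.vertex (i + 1))) = 0 := by
  simp [bary, baryLin]

theorem bary_add_two (i : Fin 3) : T.bary i (toPlane (T.vertex (i + 2))) = 0 := by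
  simp only [bary, baryLin, toPlane, Prod.mk_sub_mk]
  ring

theorem bary_vertex_nonneg (i j : Fin 3) : 0 ≤ T.bary i (toPlane (T.vertex j)) := by
  have h : ∀ i j : Fin 3, j = i ∨ j = i + 1 ∨ j = i + 2 := by decide
  rcases h i j with rfl | rfl | rfl
  · rw [bary_self]; exact zero_le_one
  · rw [bary_add_one]
  · rw [bary_add_two]

theorem mem_carrier {x : ℝ × ℝ} : x ∈ T.carrier ↔ ∀ i, 0 ≤ T.bary i x := by
  constructor
  · intro hx i
    have hconv : Convex ℝ {y | 0 ≤ T.bary i y} := by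
      intro y hy z hz r s hr hs hrs
      simp only [Set.mem_ofPred_eq] at hy hz ⊢
      rw [bary_combo _ _ _ _ hrs]
      positivity
    refine convexHull_min ?_ hconv hx
    rintro _ ⟨j, rfl⟩
    exact T.bary_vertex_nonneg i j
  · intro hx
    have h0 := T.sum_bary x
    have hv : ∀ j, toPlane (T.vertex j) ∈ T.carrier := fun j =>
      subset_convexHull ℝ _ ⟨j, rfl⟩
    have := (convex_convexHull ℝ (Set.range fun i => toPlane (T.vertex i))).sum_mem
      (t := Finset.univ) (w := fun i => T.bary i x) (z := fun j => toPlane (T.vertex j))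
      (fun i _ => hx i) (by rw [Fin.sum_univ_three]; exact h0) (fun j _ => hv j)
    rw [Fin.sum_univ_three] at this
    rw [T.eq_sum_bary x]
    exact this

theorem isOpen_openTri : IsOpen T.openTri := by
  have : T.openTri = ⋂ i, {x | 0 < T.bary i x} := by ext; simp [openTri]
  rw [this]
  exact isOpen_iInter_of_finite fun i => isOpen_lt continuous_const (T.continuous_bary i)

theorem convex_openTri : Convex ℝ T.openTri := by
  intro y hy z hz r s hr hs hrs i
  rw [bary_combo _ _ _ _ hrs]
  have h1 := hy i
  have h2 := hz i
  rcases hr.eq_or_lt with rfl | hr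
  · obtain rfl : s = 1 := by linarith
    simpa using h2
  · positivity

theorem openTri_subset_carrier : T.openTri ⊆ T.carrier := fun _ hx =>
  T.mem_carrier.2 fun i => (hx i).le

theorem openTri_subset_interior : T.openTri ⊆ interior T.carrier :=
  interior_maximal T.openTri_subset_carrier T.isOpen_openTri

/-- The centroid. -/
noncomputable def center : ℝ × ℝ :=
  (1 / 3 : ℝ) • toPlane (T.vertex 0) +
    (2 / 3 : ℝ) • ((1 / 2 : ℝ) • toPlane (T.vertex 1) + (1 / 2 : ℝ) • toPlane (T.vertex 2))

theorem center_mem : T.center ∈ T.openTri := by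
  intro i
  rw [center, bary_combo _ _ _ _ (by norm_num), bary_combo _ _ _ _ (by norm_num)]
  have h0 := T.bary_vertex_nonneg i 0
  have h1 := T.bary_vertex_nonneg i 1
  have h2 := T.bary_vertex_nonneg i 2
  have := T.bary_self i
  fin_cases i
  · have h : T.bary 0 (toPlane (T.vertex 0)) = 1 := this
    simp only [Fin.zero_eta] at *
    linarith
  · have h : T.bary 1 (toPlane (T.vertex 1)) = 1 := this
    simp only [Fin.mk_one] at *
    linarith
  · have h : T.bary 2 (toPlane (T.vertex 2)) = 1 := this
    simp only [Fin.reduceFinMk] at *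
    linarith

theorem isCompact_carrier : IsCompact T.carrier :=
  (Set.finite_range _).isCompact_convexHull ℝ

theorem carrier_subset_closure : T.carrier ⊆ closure T.openTri := by
  intro x hx
  rw [mem_carrier] at hx
  have hlim : Tendsto (fun r : ℝ => (1 - r) • x + r • T.center) (𝓝[>] 0) (𝓝 x) := by
    have : Continuous fun r : ℝ => (1 - r) • x + r • T.center := by fun_prop
    have h := this.tendsto 0
    simp only [sub_zero, one_smul, zero_smul, add_zero] at h
    exact h.mono_left nhdsWithin_le_nhds
  refine mem_closure_of_tendsto hlim ?_
  filter_upwards [Ioo_mem_nhdsGT (zero_lt_one' ℝ)] with r hr i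
  rw [bary_combo _ _ _ _ (by ring)]
  have h1 := hx i
  have h2 := T.center_mem i
  have h3 : 0 ≤ 1 - r := by linarith [hr.2]
  have := hr.1
  positivity

/-- The side opposite to the `i`-th vertex is the face of the triangle on which the `i`-th
barycentric coordinate vanishes. -/
theorem mem_side_iff (i : Fin 3) {x : ℝ × ℝ} :
    x ∈ segment ℝ (toPlane (T.vertex (i + 1))) (toPlane (T.vertex (i + 2))) ↔
      T.bary i x = 0 ∧ ∀ j, 0 ≤ T.bary j x := by
  constructor
  · rintro ⟨r, s, hr, hs, hrs, rfl⟩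
    refine ⟨?_, fun j => ?_⟩
    · rw [bary_combo _ _ _ _ hrs, bary_add_one, bary_add_two]; simp
    · rw [bary_combo _ _ _ _ hrs]
      have h1 := T.bary_vertex_nonneg j (i + 1)
      have h2 := T.bary_vertex_nonneg j (i + 2)
      positivity
  · rintro ⟨h0, h⟩
    refine ⟨T.bary (i + 1) x, T.bary (i + 2) x, h _, h _, ?_, ?_⟩
    · have hs := T.sum_bary x
      fin_cases i <;> simp only [Fin.zero_eta, Fin.mk_one, Fin.reduceFinMk, Fin.isValue,
        Fin.reduceAdd, zero_add] at h0 ⊢ <;> linarith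
    · have hs := T.eq_sum_bary x
      conv_rhs => rw [hs]
      fin_cases i <;> simp only [Fin.zero_eta, Fin.mk_one, Fin.reduceFinMk, Fin.isValue,
        Fin.reduceAdd, zero_add] at h0 ⊢ <;> rw [h0] <;> simp [add_comm]

theorem vertex_ne (i : Fin 3) : T.vertex (i + 1) ≠ T.vertex (i + 2) := fun h => by
  have := T.vertex_injective h
  fin_cases i <;> simp at this

theorem mem_edges {e : Sym2 (ℤ × ℤ)} :
    e ∈ T.edges ↔ ∃ i : Fin 3, e ∈ sideEdges (T.vertex (i + 1)) (T.vertex (i + 2)) := by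
  simp only [edges, List.mem_append]
  constructor
  · rintro ((h | h) | h)
    · exact ⟨0, h⟩
    · exact ⟨1, h⟩
    · exact ⟨2, h⟩
  · rintro ⟨i, h⟩
    fin_cases i
    · exact Or.inl (Or.inl h)
    · exact Or.inl (Or.inr h)
    · exact Or.inr h

theorem primAdj_of_mem_edges {u w : ℤ × ℤ} (h : s(u, w) ∈ T.edges) : PrimAdj u w := by
  obtain ⟨i, hi⟩ := T.mem_edges.1 h
  exact primAdj_of_mem_sideEdges (T.vertex_ne i) hi

/-- Boundary edges lie in the closed triangle and miss the open one. -/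
theorem segment_of_mem_edges {u w : ℤ × ℤ} (h : s(u, w) ∈ T.edges) {x : ℝ × ℝ}
    (hx : x ∈ segment ℝ (toPlane u) (toPlane w)) : x ∈ T.carrier ∧ x ∉ T.openTri := by
  obtain ⟨i, hi⟩ := T.mem_edges.1 h
  have := (T.mem_side_iff i).1 (segment_subset_of_mem_sideEdges (T.vertex_ne i) hi hx)
  exact ⟨T.mem_carrier.2 this.2, fun hc => (hc i).ne' this.1⟩

/-- A point of the closed triangle outside the open one lies on a side. -/
theorem exists_side {x : ℝ × ℝ} (hx : x ∈ T.carrier) (hx' : x ∉ T.openTri) :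
    ∃ i : Fin 3, x ∈ segment ℝ (toPlane (T.vertex (i + 1))) (toPlane (T.vertex (i + 2))) := by
  rw [mem_carrier] at hx
  simp only [openTri, Set.mem_ofPred_eq, not_forall, not_lt] at hx'
  obtain ⟨i, hi⟩ := hx'
  exact ⟨i, (T.mem_side_iff i).2 ⟨le_antisymm hi (hx i), hx⟩⟩

theorem exists_eq_vertex {i j : Fin 3} (hij : i ≠ j) {x : ℝ × ℝ} (hi : T.bary i x = 0)
    (hj : T.bary j x = 0) : ∃ k, x = toPlane (T.vertex k) := by
  have hs := T.sum_bary x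
  have he := T.eq_sum_bary x
  fin_cases i <;> fin_cases j <;>
    simp only [Fin.zero_eta, Fin.mk_one, Fin.reduceFinMk, Fin.isValue, ne_eq, not_true_eq_false]
      at hi hj hij <;> simp only [hi, hj, zero_add, add_zero] at hs <;>
    rw [hi, hj, hs] at he <;> simp only [zero_smul, one_smul, zero_add, add_zero] at he <;>
    exact ⟨_, he⟩

theorem disjoint_sideEdges {i j : Fin 3} (hij : i ≠ j) :
    (sideEdges (T.vertex (i + 1)) (T.vertex (i + 2))).Disjoint
      (sideEdges (T.vertex (j + 1)) (T.vertex (j + 2))) := by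
  intro e hi hj
  induction e using Sym2.ind with
  | _ u w =>
    have hp := primAdj_of_mem_sideEdges (T.vertex_ne i) hi
    have hm : edgePt u w (√2 - 1) ∈ segment ℝ (toPlane u) (toPlane w) := by
      rw [mem_segment_iff_edgePt]
      exact ⟨_, sqrt_two_sub_one_pos.le, sqrt_two_sub_one_lt.le, rfl⟩
    have h1 := (T.mem_side_iff i).1 (segment_subset_of_mem_sideEdges (T.vertex_ne i) hi hm)
    have h2 := (T.mem_side_iff j).1 (segment_subset_of_mem_sideEdges (T.vertex_ne j) hj hm)
    obtain ⟨k, hk⟩ := T.exists_eq_vertex hij h1.1 h2.1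
    exact edgePt_ne_toPlane hp irrational_sqrt_two_sub_one _ hk

theorem nodup_edges : T.edges.Nodup := by
  have h0 := T.disjoint_sideEdges (i := 0) (j := 1) (by decide)
  have h1 := T.disjoint_sideEdges (i := 0) (j := 2) (by decide)
  have h2 := T.disjoint_sideEdges (i := 1) (j := 2) (by decide)
  refine List.Nodup.append (List.Nodup.append (nodup_sideEdges (T.vertex_ne 0))
    (nodup_sideEdges (T.vertex_ne 1)) h0) (nodup_sideEdges (T.vertex_ne 2)) ?_
  exact List.disjoint_append_left.2 ⟨h1, h2⟩

end LatticeTriangle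

/-- Signs of three affine functions `b i + ε * c i` of a small parameter `ε`, at most one of which
vanishes at `ε = 0`.  If `b` are barycentric coordinates of a boundary point, then exactly one of
the two directions enters the triangle. -/
theorem germ_signs (b c : Fin 3 → ℝ) (h1 : ∀ i, b i = 0 → c i ≠ 0)
    (h2 : ∀ i j, b i = 0 → b j = 0 → i = j) :
    ∀ᶠ ε : ℝ in 𝓝[>] 0,
      (∑ i, {i | b i = 0 ∧ ∀ j, 0 ≤ b j}.indicator (fun _ => (1 : ZMod 2)) i =
        {r : ℝ | ∀ i, 0 < b i + r * c i}.indicator (fun _ => (1 : ZMod 2)) ε +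
        {r : ℝ | ∀ i, 0 < b i + r * c i}.indicator (fun _ => (1 : ZMod 2)) (-ε)) ∧
      ((∀ i, 0 ≤ b i + ε * c i) → ∀ i, 0 < b i + ε * c i) ∧
      ((∀ i, 0 ≤ b i + -ε * c i) → ∀ i, 0 < b i + -ε * c i) := by
  have hlim : ∀ i, Tendsto (fun r : ℝ => b i + r * c i) (𝓝[>] 0) (𝓝 (b i)) := by
    intro i
    have : Continuous fun r : ℝ => b i + r * c i := by fun_prop
    simpa using (this.tendsto 0).mono_left nhdsWithin_le_nhds
  have hlim' : ∀ i, Tendsto (fun r : ℝ => b i + -r * c i) (𝓝[>] 0) (𝓝 (b i)) := by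
    intro i
    have : Continuous fun r : ℝ => b i + -r * c i := by fun_prop
    simpa using (this.tendsto 0).mono_left nhdsWithin_le_nhds
  have hpos : ∀ᶠ ε : ℝ in 𝓝[>] 0, ∀ i, 0 < b i → 0 < b i + ε * c i ∧ 0 < b i + -ε * c i := by
    rw [eventually_all]
    intro i
    by_cases hb : 0 < b i
    · filter_upwards [(hlim i).eventually_const_lt hb, (hlim' i).eventually_const_lt hb]
        with ε h3 h4 _ using ⟨h3, h4⟩
    · exact Eventually.of_forall fun _ h => absurd h hb
  have hneg : ∀ᶠ ε : ℝ in 𝓝[>] 0, ∀ i, b i < 0 → b i + ε * c i < 0 ∧ b i + -ε * c i < 0 := by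
    rw [eventually_all]
    intro i
    by_cases hb : b i < 0
    · filter_upwards [(hlim i).eventually_lt_const hb, (hlim' i).eventually_lt_const hb]
        with ε h3 h4 _ using ⟨h3, h4⟩
    · exact Eventually.of_forall fun _ h => absurd h hb
  filter_upwards [hpos, hneg, self_mem_nhdsWithin] with ε hp hn hε
  have hε' : 0 < ε := hε
  have hne : ∀ i, b i + ε * c i ≠ 0 ∧ b i + -ε * c i ≠ 0 := by
    intro i
    rcases lt_trichotomy (b i) 0 with hb | hb | hb
    · exact ⟨(hn i hb).1.ne, (hn i hb).2.ne⟩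
    · rw [hb]
      simp [hε'.ne', h1 i hb]
    · exact ⟨(hp i hb).1.ne', (hp i hb).2.ne'⟩
  refine ⟨?_, fun h i => lt_of_le_of_ne (h i) (hne i).1.symm,
    fun h i => lt_of_le_of_ne (h i) (hne i).2.symm⟩
  by_cases hz : ∃ i, b i = 0
  · obtain ⟨i, hi⟩ := hz
    rw [Finset.sum_eq_single i]
    · by_cases hall : ∀ j, 0 ≤ b j
      · have hj : ∀ j, j ≠ i → 0 < b j := fun j hj =>
          lt_of_le_of_ne (hall j) fun hc => hj (h2 _ _ hc.symm hi)
        rw [Set.indicator_of_mem (by exact ⟨hi, hall⟩)]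
        rcases lt_or_gt_of_ne (h1 i hi) with hc | hc
        · rw [Set.indicator_of_notMem, Set.indicator_of_mem, zero_add]
          · intro j
            by_cases hji : j = i
            · subst hji; rw [hi]; nlinarith
            · exact (hp j (hj j hji)).2
          · intro h
            have := h i
            rw [hi] at this
            nlinarith
        · rw [Set.indicator_of_mem, Set.indicator_of_notMem, add_zero]
          · intro h
            have := h i
            rw [hi] at this
            nlinarith
          · intro j
            by_cases hji : j = i
            · subst hji; rw [hi]; nlinarith
            · exact (hp j (hj j hji)).1
      · rw [Set.indicator_of_notMem (fun h => hall h.2)]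
        push Not at hall
        obtain ⟨j, hj⟩ := hall
        rw [Set.indicator_of_notMem, Set.indicator_of_notMem, add_zero]
        · exact fun h => (h j).not_gt (hn j hj).2
        · exact fun h => (h j).not_gt (hn j hj).1
    · intro j _ hji
      exact Set.indicator_of_notMem (fun h => hji (h2 _ _ h.1 hi)) _
    · simp
  · push Not at hz
    rw [Finset.sum_eq_zero fun i _ => Set.indicator_of_notMem (fun h => hz i h.1) _]
    by_cases hall : ∀ i, 0 < b i
    · rw [Set.indicator_of_mem (by exact fun i => (hp i (hall i)).1),
        Set.indicator_of_mem (by exact fun i => (hp i (hall i)).2)]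
      decide
    · push Not at hall
      obtain ⟨j, hj⟩ := hall
      have hj' := lt_of_le_of_ne hj (hz j)
      rw [Set.indicator_of_notMem, Set.indicator_of_notMem, add_zero]
      · exact fun h => (h j).not_gt (hn j hj').2
      · exact fun h => (h j).not_gt (hn j hj').1

/-- Whether `x` lies in `S`, modulo two. -/
noncomputable def ind (S : Set (ℝ × ℝ)) (x : ℝ × ℝ) : ZMod 2 :=
  S.indicator (fun _ => 1) x

theorem ind_of_mem {S : Set (ℝ × ℝ)} {x : ℝ × ℝ} (h : x ∈ S) : ind S x = 1 :=
  Set.indicator_of_mem h _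

theorem ind_of_notMem {S : Set (ℝ × ℝ)} {x : ℝ × ℝ} (h : x ∉ S) : ind S x = 0 :=
  Set.indicator_of_notMem h _

/-- A direction transversal to the line through the lattice points `u` and `w`. -/
def Transversal (u w : ℤ × ℤ) (n : ℝ × ℝ) : Prop :=
  ((w.1 - u.1 : ℤ) : ℝ) * n.2 - ((w.2 - u.2 : ℤ) : ℝ) * n.1 ≠ 0

theorem tendsto_add_smul (g n : ℝ × ℝ) (σ : ℝ) :
    Tendsto (fun ε : ℝ => g + (σ * ε) • n) (𝓝[>] 0) (𝓝 g) := by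
  have : Continuous fun ε : ℝ => g + (σ * ε) • n := by fun_prop
  simpa using (this.tendsto 0).mono_left nhdsWithin_le_nhds

theorem LatticeTriangle.baryLin_ne_zero (T : LatticeTriangle) {u w : ℤ × ℤ} (huw : PrimAdj u w)
    {n : ℝ × ℝ} (hn : Transversal u w n) {t : ℝ} (ht : Irrational t) {i : Fin 3}
    (hi : T.bary i (edgePt u w t) = 0) : T.baryLin i n ≠ 0 := by
  have hd := T.cast_det_ne_zero
  set a := T.vertex (i + 1) with ha
  set b := T.vertex (i + 2) with hb
  have hab : a ≠ b := T.vertex_ne i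
  simp only [bary, baryLin, div_eq_zero_iff, hd, or_false, ← ha, ← hb, edgePt, toPlane,
    Prod.mk_sub_mk] at hi
  obtain ⟨-, h2⟩ := int_line_of_irrational ht
    (a := (b.1 - a.1) * (u.2 - a.2) - (b.2 - a.2) * (u.1 - a.1))
    (b := (b.1 - a.1) * (w.2 - u.2) - (b.2 - a.2) * (w.1 - u.1)) (by push_cast; linarith)
  obtain ⟨k, hk1, hk2⟩ := exists_mul_of_isCoprime huw (x := b.1 - a.1) (y := b.2 - a.2)
    (by linarith)
  have hk : k ≠ 0 := by
    rintro rfl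
    exact hab (Prod.ext (by linarith) (by linarith))
  have hk' : (k : ℝ) ≠ 0 := by exact_mod_cast hk
  have hr1 : (b.1 : ℝ) - a.1 = k * (w.1 - u.1) := by exact_mod_cast hk1
  have hr2 : (b.2 : ℝ) - a.2 = k * (w.2 - u.2) := by exact_mod_cast hk2
  simp only [baryLin, ← ha, ← hb, hr1, hr2]
  unfold Transversal at hn
  push_cast at hn
  refine div_ne_zero ?_ hd
  have : (k : ℝ) * (w.1 - u.1) * n.2 - k * (w.2 - u.2) * n.1 =
    k * ((w.1 - u.1) * n.2 - (w.2 - u.2) * n.1) := by ring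
  rw [this]
  exact mul_ne_zero hk' hn

/-- A primitive edge lies on the boundary of a lattice triangle if and only if exactly one side of
the edge, near an irrational point, belongs to the triangle. -/
theorem LatticeTriangle.count_edges (T : LatticeTriangle) {u w : ℤ × ℤ} (huw : PrimAdj u w)
    {n : ℝ × ℝ} (hn : Transversal u w n) {t : ℝ} (ht : Irrational t) (h0 : 0 < t) (h1 : t < 1) :
    ∀ᶠ ε : ℝ in 𝓝[>] 0,
      ((T.edges.count s(u, w) : ℕ) : ZMod 2) = ind T.openTri (edgePt u w t + ε • n) +
        ind T.openTri (edgePt u w t + -ε • n) ∧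
      (edgePt u w t + ε • n ∈ T.carrier → edgePt u w t + ε • n ∈ T.openTri) ∧
      (edgePt u w t + -ε • n ∈ T.carrier → edgePt u w t + -ε • n ∈ T.openTri) := by
  set g := edgePt u w t with hg
  have key := germ_signs (fun i => T.bary i g) (fun i => T.baryLin i n)
    (fun i hi => T.baryLin_ne_zero huw hn ht hi) (by
      intro i j hi hj
      by_contra hij
      have hv := fun v => edgePt_ne_toPlane huw ht v
      rw [← hg] at hv
      have := T.exists_eq_vertex hij hi hj
      obtain ⟨k, hk⟩ := this
      exact hv _ hk)
  have hside : ∀ i : Fin 3,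
      (((sideEdges (T.vertex (i + 1)) (T.vertex (i + 2))).count s(u, w) : ℕ) : ZMod 2) =
      {i | T.bary i g = 0 ∧ ∀ j, 0 ≤ T.bary j g}.indicator (fun _ => (1 : ZMod 2)) i := by
    intro i
    have h := edgePt_mem_segment_iff huw (T.vertex_ne i) ht h0 h1
    rw [← hg, T.mem_side_iff] at h
    by_cases hm : s(u, w) ∈ sideEdges (T.vertex (i + 1)) (T.vertex (i + 2))
    · rw [List.count_eq_one_of_mem (nodup_sideEdges (T.vertex_ne i)) hm, Set.indicator_of_mem]
      · simp
      · exact h.2 hm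
    · rw [List.count_eq_zero_of_not_mem hm, Set.indicator_of_notMem]
      · simp
      · exact fun hc => hm (h.1 hc)
  filter_upwards [key] with ε ⟨k1, k2, k3⟩
  have e1 : ∀ r : ℝ, g + r • n ∈ T.openTri ↔ ∀ i, 0 < T.bary i g + r * T.baryLin i n := by
    intro r
    simp [openTri, bary_add_smul]
  refine ⟨?_, ?_, ?_⟩
  · have e2 : ∀ r : ℝ, ind T.openTri (g + r • n) =
        {r : ℝ | ∀ i, 0 < T.bary i g + r * T.baryLin i n}.indicator (fun _ => (1 : ZMod 2)) r := by
      intro r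
      unfold ind
      by_cases hr : g + r • n ∈ T.openTri
      · rw [Set.indicator_of_mem hr, Set.indicator_of_mem]
        exact (e1 r).1 hr
      · rw [Set.indicator_of_notMem hr, Set.indicator_of_notMem]
        exact fun hc => hr ((e1 r).2 hc)
    rw [e2, e2, ← k1, Fin.sum_univ_three, ← hside, ← hside, ← hside]
    simp [edges, List.count_append, add_assoc]
  · intro h
    rw [mem_carrier] at h
    rw [e1]
    simp only [bary_add_smul] at h
    exact k2 h
  · intro h
    rw [mem_carrier] at h
    rw [e1]
    simp only [bary_add_smul] at h
    exact k3 h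

/-! ### Winding numbers of lattice walks -/

/-- A point of the plane as a complex number. -/
def toC (x : ℝ × ℝ) : ℂ := ⟨x.1, x.2⟩

theorem toC_eq : toC = Complex.equivRealProdCLM.symm := by
  funext x
  apply Complex.ext <;> simp [toC]

theorem continuous_toC : Continuous toC := by
  rw [toC_eq]
  exact Complex.equivRealProdCLM.symm.continuous

theorem toC_injective : Function.Injective toC := by
  rw [toC_eq]
  exact Complex.equivRealProdCLM.symm.injective

/-- The angle, in `(-π, π]`, under which the segment from `u` to `w` is seen from `x`. -/
noncomputable def argStep (u w : ℤ × ℤ) (x : ℝ × ℝ) : ℝ :=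
  Complex.arg ((toC (toPlane w) - toC x) / (toC (toPlane u) - toC x))

theorem continuousAt_argStep {u w : ℤ × ℤ} {x : ℝ × ℝ}
    (hx : x ∉ segment ℝ (toPlane u) (toPlane w)) : ContinuousAt (argStep u w) x := by
  have hu : toC (toPlane u) - toC x ≠ 0 := by
    rw [sub_ne_zero]
    intro h
    exact hx (toC_injective h ▸ left_mem_segment ℝ _ _)
  have hs : (toC (toPlane w) - toC x) / (toC (toPlane u) - toC x) ∈ Complex.slitPlane := by
    rw [Complex.mem_slitPlane_iff_not_le_zero]
    intro hle
    obtain ⟨s, hs, hs'⟩ : ∃ s : ℝ, 0 ≤ s ∧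
        (toC (toPlane w) - toC x) / (toC (toPlane u) - toC x) = -s := by
      rw [Complex.le_def] at hle
      refine ⟨-((toC (toPlane w) - toC x) / (toC (toPlane u) - toC x)).re,
        by simpa using hle.1, ?_⟩
      apply Complex.ext
      · simp
      · simpa using hle.2
    rw [div_eq_iff hu] at hs'
    apply hx
    refine ⟨s / (1 + s), 1 / (1 + s), by positivity, by positivity, by field_simp; ring, ?_⟩
    have h1 := congrArg Complex.re hs'
    have h2 := congrArg Complex.im hs'
    simp [toC] at h1 h2
    have h3 : 1 + s ≠ 0 := by positivity
    apply Prod.ext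
    · simp
      field_simp
      linarith
    · simp
      field_simp
      linarith
  unfold argStep
  refine (Complex.continuousAt_arg hs).comp (f := fun x => (toC (toPlane w) - toC x) /
    (toC (toPlane u) - toC x)) ?_
  have := continuous_toC
  exact ContinuousAt.div (by fun_prop) (by fun_prop) hu

theorem tendsto_argStep_cobounded (u w : ℤ × ℤ) :
    Tendsto (argStep u w) (Bornology.cobounded _) (𝓝 0) := by
  have h1 : Tendsto (fun x => toC (toPlane u) - toC x) (Bornology.cobounded _)
      (Bornology.cobounded ℂ) := by
    refine (tendsto_const_sub_cobounded _).comp ?_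
    rw [toC_eq]
    exact Complex.equivRealProdCLM.symm.antilipschitz.tendsto_cobounded
  have h2 : Tendsto (fun x => 1 + (toC (toPlane w) - toC (toPlane u)) *
      (toC (toPlane u) - toC x)⁻¹) (Bornology.cobounded _) (𝓝 1) := by
    have := ((Filter.tendsto_inv₀_cobounded.comp h1).const_mul
      (toC (toPlane w) - toC (toPlane u))).const_add 1
    simpa using this
  have h3 : Tendsto (fun x => (toC (toPlane w) - toC x) / (toC (toPlane u) - toC x))
      (Bornology.cobounded _) (𝓝 1) := by
    refine h2.congr' ?_
    filter_upwards [h1.eventually (Bornology.eventually_ne_cobounded 0)] with x hx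
    field_simp
    ring
  have h4 := (Complex.continuousAt_arg (x := 1) (by simp)).tendsto.comp h3
  rwa [Complex.arg_one] at h4

section Walks

variable {G : SimpleGraph (ℤ × ℤ)} {u v : ℤ × ℤ}

/-- The total angle swept by a walk, seen from `x`. -/
noncomputable def totalArg (p : G.Walk u v) (x : ℝ × ℝ) : ℝ :=
  (p.darts.map fun d => argStep d.fst d.snd x).sum

/-- The winding number of a closed walk around `x`; it is meaningful off the walk only. -/
noncomputable def windingNumber (p : G.Walk u v) (x : ℝ × ℝ) : ℤ :=
  round (totalArg p x / (2 * Real.pi))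

/-- The point `x` does not lie on the polygonal curve traced by the walk. -/
def Avoids (p : G.Walk u v) (x : ℝ × ℝ) : Prop :=
  ∀ a b, s(a, b) ∈ p.edges → x ∉ segment ℝ (toPlane a) (toPlane b)

theorem coe_totalArg (p : G.Walk u v) {x : ℝ × ℝ}
    (hx : ∀ e ∈ p.edges, ∀ a ∈ e, x ≠ toPlane a) :
    (totalArg p x : Real.Angle) =
      Complex.arg (toC (toPlane v) - toC x) - Complex.arg (toC (toPlane u) - toC x) := by
  induction p with
  | nil => simp [totalArg]
  | @cons u w v h p ih =>
    have ih' := ih fun e he => hx e (by simp [he])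
    have hne : ∀ a ∈ s(u, w), toC (toPlane a) - toC x ≠ 0 := fun a ha =>
      sub_ne_zero.2 fun hc => hx s(u, w) (by simp) a ha (toC_injective hc).symm
    have e1 : totalArg (SimpleGraph.Walk.cons h p) x = argStep u w x + totalArg p x := by
      simp [totalArg]
    rw [e1, Real.Angle.coe_add, ih', argStep,
      Complex.arg_div_coe_angle (hne w (by simp)) (hne u (by simp))]
    abel

theorem totalArg_eq (p : G.Walk u u) {x : ℝ × ℝ}
    (hx : ∀ e ∈ p.edges, ∀ a ∈ e, x ≠ toPlane a) :
    totalArg p x = 2 * Real.pi * windingNumber p x := by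
  have h := coe_totalArg p hx
  rw [sub_self, Real.Angle.coe_eq_zero_iff] at h
  obtain ⟨n, hn⟩ := h
  have hpi := Real.pi_ne_zero
  rw [windingNumber, ← hn, zsmul_eq_mul, mul_div_assoc, div_self (by positivity), mul_one,
    round_intCast]
  ring

theorem Avoids.ne {p : G.Walk u v} {x : ℝ × ℝ} (h : Avoids p x) :
    ∀ e ∈ p.edges, ∀ a ∈ e, x ≠ toPlane a := by
  rintro e he a ha rfl
  obtain ⟨b, rfl⟩ := ha
  exact h a b he (left_mem_segment ℝ _ _)

theorem continuousAt_totalArg {p : G.Walk u v} {x : ℝ × ℝ} (h : Avoids p x) :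
    ContinuousAt (totalArg p) x := by
  unfold ContinuousAt totalArg
  refine tendsto_list_sum _ fun d hd => ?_
  exact continuousAt_argStep (h _ _ (List.mem_map_of_mem (f := SimpleGraph.Dart.edge) hd))

/-- The winding number is constant on connected sets off the walk. -/
theorem windingNumber_eq_of_isPreconnected {p : G.Walk u u} {S : Set (ℝ × ℝ)}
    (hS : IsPreconnected S) (hp : ∀ x ∈ S, Avoids p x) {x y : ℝ × ℝ} (hx : x ∈ S) (hy : y ∈ S) :
    windingNumber p x = windingNumber p y := by
  have hc : ContinuousOn (totalArg p) S := fun z hz =>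
    (continuousAt_totalArg (hp z hz)).continuousWithinAt
  have hpi := Real.pi_pos
  have key : ∀ x ∈ S, ∀ y ∈ S, ¬ windingNumber p x < windingNumber p y := by
    intro x hx y hy hlt
    have hlt' : (windingNumber p x : ℝ) + 1 ≤ windingNumber p y := by exact_mod_cast hlt
    have h1 := totalArg_eq p (hp x hx).ne
    have h2 := totalArg_eq p (hp y hy).ne
    have hm : 2 * Real.pi * (windingNumber p x + 1 / 2) ∈
        Set.Icc (totalArg p x) (totalArg p y) := by
      rw [h1, h2]
      constructor <;> gcongr <;> linarith
    -- an intermediate value would give a half-integral winding number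
    obtain ⟨z, hz, hz'⟩ := hS.intermediate_value hx hy hc hm
    rw [totalArg_eq p (hp z hz).ne] at hz'
    have h3 := mul_left_cancel₀ (by positivity) hz'
    have h4 : 2 * windingNumber p z = 2 * windingNumber p x + 1 := by
      have : (2 * windingNumber p z : ℝ) = 2 * windingNumber p x + 1 := by linarith
      exact_mod_cast this
    omega
  exact le_antisymm (not_lt.1 (key y hy x hx)) (not_lt.1 (key x hx y hy))

/-- The winding number vanishes on unbounded connected sets off the walk. -/
theorem windingNumber_eq_zero {p : G.Walk u u} {S : Set (ℝ × ℝ)} (hS : IsPreconnected S)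
    (hp : ∀ x ∈ S, Avoids p x) (hb : ¬ Bornology.IsBounded S) {x : ℝ × ℝ} (hx : x ∈ S) :
    windingNumber p x = 0 := by
  have hlim : Tendsto (totalArg p) (Bornology.cobounded _) (𝓝 0) := by
    unfold totalArg
    have := tendsto_list_sum p.darts (fun d _ => tendsto_argStep_cobounded d.fst d.snd)
    simpa using this
  have hev : ∀ᶠ y in Bornology.cobounded (ℝ × ℝ), |totalArg p y| < 2 * Real.pi := by
    have := hlim.abs
    rw [abs_zero] at this
    exact this.eventually_lt_const (by positivity)
  have hfr : ∃ᶠ y in Bornology.cobounded (ℝ × ℝ), y ∈ S := by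
    intro hc
    exact hb (Bornology.isBounded_def.2 hc)
  obtain ⟨y, hy, hy'⟩ := (hfr.and_eventually hev).exists
  rw [windingNumber_eq_of_isPreconnected hS hp hx hy]
  rw [totalArg_eq p (hp y hy).ne, abs_mul, abs_of_pos Real.two_pi_pos] at hy'
  have h1 : |(windingNumber p y : ℝ)| < 1 := by
    by_contra! hc
    nlinarith [Real.two_pi_pos]
  have h2 : |windingNumber p y| < 1 := by exact_mod_cast h1
  exact Int.abs_lt_one_iff.1 h2

end Walks

/-- The vector from `u` to `w`, rotated by a right angle. -/
def normal (u w : ℤ × ℤ) : ℝ × ℝ := (-(w.2 - u.2), w.1 - u.1)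

theorem transversal_normal {u w : ℤ × ℤ} (h : u ≠ w) : Transversal u w (normal u w) := by
  intro hc
  simp only [normal, Int.cast_sub] at hc
  apply h
  obtain ⟨h1, h2⟩ := mul_self_add_mul_self_eq_zero.1
    (show ((w.1 : ℝ) - u.1) * (w.1 - u.1) + (w.2 - u.2) * (w.2 - u.2) = 0 by linarith)
  apply Prod.ext
  · exact_mod_cast (sub_eq_zero.1 h1).symm
  · exact_mod_cast (sub_eq_zero.1 h2).symm

/-- Across an edge the angle under which it is seen jumps by a full turn. -/
theorem tendsto_argStep_jump {u w : ℤ × ℤ} (h : u ≠ w) {t : ℝ} (h0 : 0 < t) (h1 : t < 1) :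
    Tendsto (fun ε : ℝ => argStep u w (edgePt u w t + ε • normal u w)) (𝓝[>] 0) (𝓝 Real.pi) ∧
    Tendsto (fun ε : ℝ => argStep u w (edgePt u w t + -ε • normal u w)) (𝓝[>] 0)
      (𝓝 (-Real.pi)) := by
  set δ : ℂ := toC (toPlane w) - toC (toPlane u) with hδ
  have hδ0 : δ ≠ 0 := sub_ne_zero.2 fun hc => h (toPlane_injective (toC_injective hc)).symm
  -- the quotient of the two directions, after division by the edge vector
  set F : ℝ → ℂ := fun ε => ((1 - t : ℂ) - Complex.I * ε) / (-t - Complex.I * ε) with hF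
  have hF1 : ∀ ε : ℝ, argStep u w (edgePt u w t + ε • normal u w) = Complex.arg (F ε) := by
    intro ε
    have e1 : toC (toPlane w) - toC (edgePt u w t + ε • normal u w) =
        δ * ((1 - t : ℂ) - Complex.I * ε) := by
      apply Complex.ext <;> simp [toC, toPlane, hδ, edgePt, normal] <;> ring
    have e2 : toC (toPlane u) - toC (edgePt u w t + ε • normal u w) =
        δ * (-t - Complex.I * ε) := by
      apply Complex.ext <;> simp [toC, toPlane, hδ, edgePt, normal] <;> ring
    rw [argStep, e1, e2, mul_div_mul_left _ _ hδ0]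
  have hden : ∀ ε : ℝ, (-t - Complex.I * ε : ℂ) ≠ 0 := by
    intro ε hc
    have := congrArg Complex.re hc
    simp at this
    exact h0.ne' this
  have hFc : Continuous F := by
    apply Continuous.div _ _ hden <;> fun_prop
  have him : ∀ ε : ℝ, (F ε).im = ε / (t ^ 2 + ε ^ 2) := by
    intro ε
    simp only [hF, Complex.div_im, Complex.normSq_apply]
    simp
    field_simp
    ring
  have hF0 : F 0 = ((-((1 - t) / t) : ℝ) : ℂ) := by
    simp [hF, div_neg]
  have hre : (F 0).re < 0 := by
    rw [hF0, Complex.ofReal_re]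
    have : 0 < (1 - t) / t := div_pos (by linarith) h0
    linarith
  have him0 : (F 0).im = 0 := by rw [hF0, Complex.ofReal_im]
  have hl1 : Tendsto F (𝓝[>] 0) (𝓝 (F 0)) := (hFc.tendsto 0).mono_left nhdsWithin_le_nhds
  have hl2 : Tendsto (fun ε => F (-ε)) (𝓝[>] 0) (𝓝 (F 0)) := by
    have : Continuous fun ε => F (-ε) := hFc.comp continuous_neg
    simpa using (this.tendsto 0).mono_left nhdsWithin_le_nhds
  constructor
  · simp only [hF1]
    refine (Complex.tendsto_arg_nhdsWithin_im_nonneg_of_re_neg_of_im_zero hre him0).comp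
      (tendsto_nhdsWithin_iff.2 ⟨hl1, ?_⟩)
    filter_upwards [self_mem_nhdsWithin] with ε hε
    have hε' : 0 < ε := hε
    change 0 ≤ (F ε).im
    rw [him]
    positivity
  · simp only [hF1]
    refine (Complex.tendsto_arg_nhdsWithin_im_neg_of_re_neg_of_im_zero hre him0).comp
      (tendsto_nhdsWithin_iff.2 ⟨hl2, ?_⟩)
    filter_upwards [self_mem_nhdsWithin] with ε hε
    have hε' : 0 < ε := hε
    change (F (-ε)).im < 0
    rw [him, neg_sq, neg_div]
    have : 0 < ε / (t ^ 2 + ε ^ 2) := by positivity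
    linarith

theorem sideEdges_of_primAdj {a b : ℤ × ℤ} (h : PrimAdj a b) : sideEdges a b = [s(a, b)] := by
  have h1 : sideLen a b = 1 := Int.isCoprime_iff_gcd_eq_one.1 h
  have h2 := sidePt_sideLen a b
  rw [h1] at h2
  simp [sideEdges, h1, sideEdge, sidePt_zero, h2]

/-- The jump of one angle across the edge from `u` to `w`, in full turns, is odd exactly for that
edge. -/
theorem tendsto_argStep_diff {u w a b : ℤ × ℤ} (huw : PrimAdj u w) (hab : PrimAdj a b) {t : ℝ}
    (ht : Irrational t) (h0 : 0 < t) (h1 : t < 1) :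
    ∃ k : ℤ, (k : ZMod 2) = (if s(a, b) = s(u, w) then 1 else 0) ∧
      Tendsto (fun ε : ℝ => argStep a b (edgePt u w t + ε • normal u w) -
        argStep a b (edgePt u w t + -ε • normal u w)) (𝓝[>] 0) (𝓝 (2 * Real.pi * k)) := by
  by_cases he : s(a, b) = s(u, w)
  · rw [if_pos he]
    rcases Sym2.eq_iff.1 he with ⟨rfl, rfl⟩ | ⟨rfl, rfl⟩
    · obtain ⟨j1, j2⟩ := tendsto_argStep_jump huw.ne h0 h1
      refine ⟨1, by simp, ?_⟩
      convert j1.sub j2 using 2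
      push_cast
      ring
    · obtain ⟨j1, j2⟩ := tendsto_argStep_jump hab.ne (t := 1 - t) (by linarith) (by linarith)
      have hn : ∀ r : ℝ, r • normal a b = -r • normal b a := by
        intro r
        apply Prod.ext <;> simp [normal] <;> ring
      simp only [edgePt_swap, hn, neg_neg] at j1 j2
      refine ⟨-1, by decide, ?_⟩
      convert j2.sub j1 using 2
      push_cast
      ring
  · rw [if_neg he]
    refine ⟨0, by simp, ?_⟩
    have hns : edgePt u w t ∉ segment ℝ (toPlane a) (toPlane b) := by
      rw [edgePt_mem_segment_iff huw hab.ne ht h0 h1, sideEdges_of_primAdj hab]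
      simpa using Ne.symm he
    have hc := continuousAt_argStep hns
    have l1 := hc.tendsto.comp (tendsto_add_smul _ (normal u w) 1)
    have l2 := hc.tendsto.comp (tendsto_add_smul _ (normal u w) (-1))
    have := l1.sub l2
    simpa [Function.comp_def] using this

/-- The jump of the winding number across an edge counts, modulo two, the passages of the walk
along this edge. -/
theorem windingNumber_jump {G : SimpleGraph (ℤ × ℤ)} (hG : ∀ a b, G.Adj a b → PrimAdj a b)
    {v : ℤ × ℤ} (p : G.Walk v v) {u w : ℤ × ℤ} (huw : PrimAdj u w) {t : ℝ}
    (ht : Irrational t) (h0 : 0 < t) (h1 : t < 1) :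
    ∀ᶠ ε : ℝ in 𝓝[>] 0, ((p.edges.count s(u, w) : ℕ) : ZMod 2) =
      (windingNumber p (edgePt u w t + ε • normal u w) : ZMod 2) +
        (windingNumber p (edgePt u w t + -ε • normal u w) : ZMod 2) := by
  have key : ∀ l : List G.Dart, ∃ k : ℤ,
      (k : ZMod 2) = (((l.map SimpleGraph.Dart.edge).count s(u, w) : ℕ) : ZMod 2) ∧
      Tendsto (fun ε : ℝ =>
        (l.map fun d => argStep d.fst d.snd (edgePt u w t + ε • normal u w)).sum -
        (l.map fun d => argStep d.fst d.snd (edgePt u w t + -ε • normal u w)).sum)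
        (𝓝[>] 0) (𝓝 (2 * Real.pi * k)) := by
    intro l
    induction l with
    | nil => exact ⟨0, by simp, by simp⟩
    | cons d l ih =>
      obtain ⟨k, hk, hk'⟩ := ih
      obtain ⟨j, hj, hj'⟩ := tendsto_argStep_diff huw (hG _ _ d.adj) ht h0 h1
      refine ⟨j + k, ?_, ?_⟩
      · push_cast
        rw [hj, hk, List.map_cons, List.count_cons]
        have : d.edge = s(d.fst, d.snd) := rfl
        simp only [this, beq_iff_eq]
        split_ifs <;> simp [add_comm]
      · convert hj'.add hk' using 2
        · simp only [List.map_cons, List.sum_cons]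
          ring
        · push_cast
          ring
  obtain ⟨k, hk, hk'⟩ := key p.darts
  have hdist := (Metric.tendsto_nhds.1 hk') (2 * Real.pi) Real.two_pi_pos
  have hne : ∀ σ : ℝ, ∀ᶠ ε : ℝ in 𝓝[>] 0, ∀ a ∈ p.support,
      edgePt u w t + (σ * ε) • normal u w ≠ toPlane a := by
    intro σ
    have hfin : {a | a ∈ p.support}.Finite := List.finite_toSet _
    exact (eventually_all_finite hfin).2 fun a _ =>
      (tendsto_add_smul _ _ σ).eventually_ne (edgePt_ne_toPlane huw ht a)
  filter_upwards [hdist, hne 1, hne (-1)] with ε h2 h3 h4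
  simp only [one_mul, neg_one_mul] at h3 h4
  have hsup : ∀ e ∈ p.edges, ∀ a ∈ e, a ∈ p.support := by
    intro e he a ha
    obtain ⟨b, rfl⟩ := ha
    exact p.fst_mem_support_of_mem_edges he
  have e1 := totalArg_eq p (fun e he a ha => h3 a (hsup e he a ha))
  have e2 := totalArg_eq p (fun e he a ha => h4 a (hsup e he a ha))
  unfold totalArg at e1 e2
  rw [e1, e2, Real.dist_eq, ← mul_sub, ← mul_sub, abs_mul, abs_of_pos Real.two_pi_pos] at h2
  have h5 : |((windingNumber p (edgePt u w t + ε • normal u w) : ℝ) -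
      windingNumber p (edgePt u w t + -ε • normal u w) - k)| < 1 := by
    by_contra! hc
    nlinarith [Real.two_pi_pos]
  have h6 : windingNumber p (edgePt u w t + ε • normal u w) -
      windingNumber p (edgePt u w t + -ε • normal u w) - k = 0 := by
    apply Int.abs_lt_one_iff.1
    exact_mod_cast h5
  have h7 : k = windingNumber p (edgePt u w t + ε • normal u w) -
      windingNumber p (edgePt u w t + -ε • normal u w) := by linarith
  change (((p.darts.map SimpleGraph.Dart.edge).count s(u, w) : ℕ) : ZMod 2) = _
  rw [← hk, h7, Int.cast_sub, CharTwo.sub_eq_add]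

/-! ### The edge graph of a dissection and its cohomology -/

section Dissection

variable {m : ℕ} {T : Fin m → LatticeTriangle} {R : Set (ℝ × ℝ)}

/-- The graph on the lattice formed by the primitive boundary edges of all triangles. -/
def edgeGraph (T : Fin m → LatticeTriangle) : SimpleGraph (ℤ × ℤ) where
  Adj u w := ∃ i, s(u, w) ∈ (T i).edges
  symm := ⟨fun u w ⟨i, hi⟩ => ⟨i, Sym2.eq_swap (a := u) (b := w) ▸ hi⟩⟩
  loopless := ⟨fun _ ⟨i, hi⟩ => ((T i).primAdj_of_mem_edges hi).ne rfl⟩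

theorem primAdj_of_adj {u w : ℤ × ℤ} (h : (edgeGraph T).Adj u w) : PrimAdj u w := by
  obtain ⟨i, hi⟩ := h
  exact (T i).primAdj_of_mem_edges hi

/-- The number of triangles, modulo two, with a given edge on their boundary. -/
def boundaryChain (T : Fin m → LatticeTriangle) (e : Sym2 (ℤ × ℤ)) : ZMod 2 :=
  ∑ i, (((T i).edges.count e : ℕ) : ZMod 2)

/-- The finite set of all edges of the triangles. -/
def allEdges (T : Fin m → LatticeTriangle) : Finset (Sym2 (ℤ × ℤ)) :=
  Finset.univ.biUnion fun i => (T i).edges.toFinset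

theorem mem_allEdges {e : Sym2 (ℤ × ℤ)} : e ∈ allEdges T ↔ ∃ i, e ∈ (T i).edges := by
  simp [allEdges]

theorem primAdj_of_mem_allEdges {u w : ℤ × ℤ} (h : s(u, w) ∈ allEdges T) : PrimAdj u w :=
  primAdj_of_adj (T := T) (mem_allEdges.1 h)

theorem boundaryChain_eq_zero {e : Sym2 (ℤ × ℤ)} (h : e ∉ allEdges T) :
    boundaryChain T e = 0 := by
  refine Finset.sum_eq_zero fun i _ => ?_
  rw [List.count_eq_zero_of_not_mem fun hc => h (mem_allEdges.2 ⟨i, hc⟩), Nat.cast_zero]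

theorem IsDissection.notMem_carrier (hT : IsDissection T R) {i j : Fin m} (hij : i ≠ j)
    {x : ℝ × ℝ} (hx : x ∈ (T i).openTri) : x ∉ (T j).carrier := by
  intro hj
  have hc := (T j).carrier_subset_closure hj
  obtain ⟨y, hy, hy'⟩ := mem_closure_iff.1 hc _ (T i).isOpen_openTri hx
  exact Set.disjoint_left.1 (hT.2 i j hij) ((T i).openTri_subset_interior hy)
    ((T j).openTri_subset_interior hy')

theorem IsDissection.mem_iff (hT : IsDissection T R) {x : ℝ × ℝ} :
    x ∈ R ↔ ∃ i, x ∈ (T i).carrier := by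
  rw [← hT.1, Set.mem_iUnion]

theorem IsDissection.isCompact (hT : IsDissection T R) : IsCompact R := by
  rw [← hT.1]
  exact isCompact_iUnion fun i => (T i).isCompact_carrier

/-- Walks along the edges stay on the boundaries of the triangles. -/
theorem IsDissection.avoids_of_mem (hT : IsDissection T R) {i : Fin m} {x : ℝ × ℝ}
    (hx : x ∈ (T i).openTri) {u v : ℤ × ℤ} (p : (edgeGraph T).Walk u v) : Avoids p x := by
  intro a b hab hs
  obtain ⟨j, hj⟩ := p.adj_of_mem_edges hab
  obtain ⟨h1, h2⟩ := (T j).segment_of_mem_edges hj hs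
  by_cases hij : i = j
  · subst hij; exact h2 hx
  · exact hT.notMem_carrier hij hx h1

theorem IsDissection.avoids_of_notMem (hT : IsDissection T R) {x : ℝ × ℝ}
    (hx : x ∉ R) {u v : ℤ × ℤ} (p : (edgeGraph T).Walk u v) : Avoids p x := by
  intro a b hab hs
  obtain ⟨j, hj⟩ := p.adj_of_mem_edges hab
  exact hx (hT.mem_iff.2 ⟨j, ((T j).segment_of_mem_edges hj hs).1⟩)

/-- Off the boundaries of the triangles, at most one triangle contributes to a weighted sum. -/
theorem IsDissection.sum_ind (hT : IsDissection T R) (φ : ℝ × ℝ → ZMod 2) (c : Fin m → ZMod 2)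
    (hφ : ∀ i, ∀ x ∈ (T i).openTri, φ x = c i) {x : ℝ × ℝ}
    (hx : ∀ i, x ∈ (T i).carrier → x ∈ (T i).openTri) :
    ∑ i, c i * ind (T i).openTri x = ind R x * φ x := by
  by_cases hR : x ∈ R
  · obtain ⟨i, hi⟩ := hT.mem_iff.1 hR
    rw [Finset.sum_eq_single i]
    · simp [ind, hR, hx i hi, hφ i x (hx i hi)]
    · intro j _ hj
      have : x ∉ (T j).openTri := fun hc =>
        hT.notMem_carrier hj.symm (hx i hi) ((T j).openTri_subset_carrier hc)
      simp [ind, this]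
    · simp
  · rw [Finset.sum_eq_zero]
    · simp [ind, hR]
    · intro i _
      have : x ∉ (T i).openTri := fun hc =>
        hR (hT.mem_iff.2 ⟨i, (T i).openTri_subset_carrier hc⟩)
      simp [ind, this]

theorem IsDissection.sum_count (hT : IsDissection T R) (φ : ℝ × ℝ → ZMod 2) (c : Fin m → ZMod 2)
    (hφ : ∀ i, ∀ x ∈ (T i).openTri, φ x = c i) {u w : ℤ × ℤ} (huw : PrimAdj u w) {n : ℝ × ℝ}
    (hn : Transversal u w n) {t : ℝ} (ht : Irrational t) (h0 : 0 < t) (h1 : t < 1) :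
    ∀ᶠ ε : ℝ in 𝓝[>] 0, ∑ i, c i * (((T i).edges.count s(u, w) : ℕ) : ZMod 2) =
      ind R (edgePt u w t + ε • n) * φ (edgePt u w t + ε • n) +
      ind R (edgePt u w t + -ε • n) * φ (edgePt u w t + -ε • n) := by
  have := eventually_all.2 fun i => (T i).count_edges huw hn ht h0 h1
  filter_upwards [this] with ε hε
  rw [← hT.sum_ind φ c hφ fun i => (hε i).2.1, ← hT.sum_ind φ c hφ fun i => (hε i).2.2,
    ← Finset.sum_add_distrib]
  refine Finset.sum_congr rfl fun i _ => ?_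
  rw [(hε i).1, mul_add]

theorem IsDissection.boundaryChain_eq (hT : IsDissection T R) {u w : ℤ × ℤ}
    (huw : PrimAdj u w) {n : ℝ × ℝ} (hn : Transversal u w n) {t : ℝ} (ht : Irrational t)
    (h0 : 0 < t) (h1 : t < 1) :
    ∀ᶠ ε : ℝ in 𝓝[>] 0, boundaryChain T s(u, w) =
      ind R (edgePt u w t + ε • n) + ind R (edgePt u w t + -ε • n) := by
  simpa [boundaryChain] using
    hT.sum_count (fun _ => 1) (fun _ => 1) (fun _ _ _ => rfl) huw hn ht h0 h1

/-- A set is filled if every point outside it can escape to infinity. -/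
def IsFilled (R : Set (ℝ × ℝ)) : Prop :=
  ∀ x ∉ R, ∃ S, IsPreconnected S ∧ x ∈ S ∧ (∀ y ∈ S, y ∉ R) ∧ ¬ Bornology.IsBounded S

/-- Modulo two, a closed walk along the edges is the sum of the boundaries of the triangles,
weighted by the winding numbers of the walk. -/
theorem IsDissection.count_eq_sum (hT : IsDissection T R) (hR : IsFilled R) {v : ℤ × ℤ}
    (p : (edgeGraph T).Walk v v) {u w : ℤ × ℤ} (huw : PrimAdj u w) :
    ((p.edges.count s(u, w) : ℕ) : ZMod 2) =
      ∑ i, (windingNumber p (T i).center : ZMod 2) *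
        (((T i).edges.count s(u, w) : ℕ) : ZMod 2) := by
  have h1 := hT.sum_count (fun x => (windingNumber p x : ZMod 2))
    (fun i => (windingNumber p (T i).center : ZMod 2)) (fun i x hx => by
      rw [windingNumber_eq_of_isPreconnected (T i).convex_openTri.isPreconnected
        (fun y hy => hT.avoids_of_mem hy p) hx (T i).center_mem]) huw
    (transversal_normal huw.ne) irrational_sqrt_two_sub_one sqrt_two_sub_one_pos
    sqrt_two_sub_one_lt
  have h2 := windingNumber_jump (G := edgeGraph T) (fun _ _ => primAdj_of_adj) p huw
    irrational_sqrt_two_sub_one sqrt_two_sub_one_pos sqrt_two_sub_one_lt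
  -- outside `R` the winding number vanishes, so the points of both sides count in any case
  have h3 : ∀ x, ind R x * (windingNumber p x : ZMod 2) = (windingNumber p x : ZMod 2) := by
    intro x
    by_cases hx : x ∈ R
    · simp [ind, hx]
    · obtain ⟨S, hS, hxS, hSR, hb⟩ := hR x hx
      rw [windingNumber_eq_zero hS (fun y hy => hT.avoids_of_notMem (hSR y hy) p) hb hxS]
      simp
  obtain ⟨ε, e1, e2⟩ := (h1.and h2).exists
  rw [e1, e2, h3, h3]

theorem sum_map_eq_sum_count (f : Sym2 (ℤ × ℤ) → ZMod 2) (l : List (Sym2 (ℤ × ℤ)))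
    {S : Finset (Sym2 (ℤ × ℤ))} (hS : ∀ e ∈ l, e ∈ S) :
    (l.map f).sum = ∑ e ∈ S, ((l.count e : ℕ) : ZMod 2) * f e := by
  rw [Finset.sum_list_map_count]
  simp only [nsmul_eq_mul]
  refine Finset.sum_subset (fun e he => hS e (List.mem_toFinset.1 he)) fun e _ he => ?_
  rw [List.count_eq_zero_of_not_mem fun hc => he (List.mem_toFinset.2 hc)]
  simp

/-- The first cohomology, modulo two, of a filled dissected set vanishes: an edge function whose
sum over each triangle is zero has zero sum over each closed walk. -/
theorem IsDissection.sum_edges_eq_zero (hT : IsDissection T R) (hR : IsFilled R)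
    (f : Sym2 (ℤ × ℤ) → ZMod 2) (hf : ∀ i, ((T i).edges.map f).sum = 0) {v : ℤ × ℤ}
    (p : (edgeGraph T).Walk v v) : (p.edges.map f).sum = 0 := by
  have hp : ∀ e ∈ p.edges, e ∈ allEdges T := by
    intro e he
    induction e using Sym2.ind with
    | _ a b => exact mem_allEdges.2 (p.adj_of_mem_edges he)
  rw [sum_map_eq_sum_count f _ hp]
  have h1 : ∀ e ∈ allEdges T, ((p.edges.count e : ℕ) : ZMod 2) * f e =
      ∑ i, (windingNumber p (T i).center : ZMod 2) *
        ((((T i).edges.count e : ℕ) : ZMod 2) * f e) := by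
    intro e he
    induction e using Sym2.ind with
    | _ a b =>
      rw [hT.count_eq_sum hR p (primAdj_of_mem_allEdges he), Finset.sum_mul]
      simp only [mul_assoc]
  rw [Finset.sum_congr rfl h1, Finset.sum_comm]
  refine Finset.sum_eq_zero fun i _ => ?_
  rw [← Finset.mul_sum, ← sum_map_eq_sum_count f (T i).edges fun e he => mem_allEdges.2 ⟨i, he⟩,
    hf, mul_zero]

/-! ### The boundary chain of a dissection -/

theorem LatticeTriangle.sum_edges_coboundary (t : LatticeTriangle) (f : Sym2 (ℤ × ℤ) → ZMod 2)
    (h : ℤ × ℤ → ZMod 2) (hf : ∀ u v, f s(u, v) = h u + h v) : (t.edges.map f).sum = 0 := by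
  simp only [LatticeTriangle.edges, List.map_append, List.sum_append,
    sum_sideEdges_coboundary _ _ f h hf]
  generalize h (t.vertex 0) = a
  generalize h (t.vertex 1) = b
  generalize h (t.vertex 2) = c
  revert a b c
  decide

/-- The boundary chain is a cycle.  In particular, if at some lattice point only two edges can
belong to the chain, then both or none of them do. -/
theorem boundaryChain_eq_of_vertex {v : ℤ × ℤ} {e₁ e₂ : Sym2 (ℤ × ℤ)} (hne : e₁ ≠ e₂)
    (h1 : v ∈ e₁) (h2 : v ∈ e₂) (hd1 : ¬ e₁.IsDiag) (hd2 : ¬ e₂.IsDiag)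
    (h : ∀ e, v ∈ e → boundaryChain T e ≠ 0 → e = e₁ ∨ e = e₂) :
    boundaryChain T e₁ = boundaryChain T e₂ := by
  classical
  -- pair the chain with the coboundary of the indicator function of `v`
  set χ : ℤ × ℤ → ZMod 2 := fun a => if a = v then 1 else 0 with hχ
  set f : Sym2 (ℤ × ℤ) → ZMod 2 :=
    Sym2.lift ⟨fun a b => χ a + χ b, fun a b => add_comm _ _⟩ with hf
  have hf1 : ∀ e : Sym2 (ℤ × ℤ), v ∈ e → ¬ e.IsDiag → f e = 1 := by
    rintro e ⟨b, rfl⟩ hb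
    have : b ≠ v := fun hc => hb (by simp [hc])
    simp [hf, hχ, this]
  have hf0 : ∀ e : Sym2 (ℤ × ℤ), v ∉ e → f e = 0 := by
    intro e he
    induction e using Sym2.ind with
    | _ a b =>
      simp only [Sym2.mem_iff, not_or] at he
      simp [hf, hχ, Ne.symm he.1, Ne.symm he.2]
  have hsum : ∑ e ∈ allEdges T, boundaryChain T e * f e = 0 := by
    simp only [boundaryChain, Finset.sum_mul]
    rw [Finset.sum_comm]
    refine Finset.sum_eq_zero fun i _ => ?_
    rw [← sum_map_eq_sum_count f (T i).edges fun e he => mem_allEdges.2 ⟨i, he⟩]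
    exact (T i).sum_edges_coboundary f χ fun _ _ => rfl
  have hpair : ∑ e ∈ ({e₁, e₂} : Finset (Sym2 (ℤ × ℤ))), boundaryChain T e * f e = 0 := by
    rw [← hsum]
    have hz : ∀ e, boundaryChain T e * f e ≠ 0 →
        e ∈ allEdges T ∧ e ∈ ({e₁, e₂} : Finset (Sym2 (ℤ × ℤ))) := by
      intro e he
      have hv : v ∈ e := by
        by_contra hc
        exact he (by rw [hf0 e hc, mul_zero])
      have hb : boundaryChain T e ≠ 0 := left_ne_zero_of_mul he
      refine ⟨by_contra fun hc => hb (boundaryChain_eq_zero hc), ?_⟩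
      simpa using h e hv hb
    rw [← Finset.sum_subset (s₁ := allEdges T ∩ {e₁, e₂}) Finset.inter_subset_left,
      ← Finset.sum_subset (s₁ := allEdges T ∩ {e₁, e₂}) Finset.inter_subset_right]
    · intro e he hne
      by_contra hc
      exact hne (Finset.mem_inter.2 ⟨(hz e hc).1, he⟩)
    · intro e he hne
      by_contra hc
      exact hne (Finset.mem_inter.2 ⟨he, (hz e hc).2⟩)
  rw [Finset.sum_pair hne, hf1 _ h1 hd1, hf1 _ h2 hd2, mul_one, mul_one] at hpair
  exact CharTwo.add_eq_zero.1 hpair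

/-- The edges of the boundary chain lie in the frontier. -/
theorem IsDissection.mem_frontier (hT : IsDissection T R) {u w : ℤ × ℤ} (huw : PrimAdj u w)
    (h : boundaryChain T s(u, w) ≠ 0) {t : ℝ} (ht : Irrational t) (h0 : 0 < t) (h1 : t < 1) :
    edgePt u w t ∈ frontier R := by
  have key := hT.boundaryChain_eq huw (transversal_normal huw.ne) ht h0 h1
  rw [frontier_eq_closure_inter_closure]
  have hU : ∀ U ∈ 𝓝 (edgePt u w t), (U ∩ R).Nonempty ∧ (U ∩ Rᶜ).Nonempty := by
    intro U hU
    obtain ⟨ε, e1, e2, e3⟩ := (key.and (((tendsto_add_smul _ _ 1).eventually_mem hU).and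
      ((tendsto_add_smul _ _ (-1)).eventually_mem hU))).exists
    simp only [one_mul, neg_one_mul] at e2 e3
    rw [e1] at h
    by_cases ha : edgePt u w t + ε • normal u w ∈ R <;>
      by_cases hb : edgePt u w t + -ε • normal u w ∈ R
    · exact absurd (by rw [ind_of_mem ha, ind_of_mem hb]; decide) h
    · exact ⟨⟨_, e2, ha⟩, ⟨_, e3, hb⟩⟩
    · exact ⟨⟨_, e3, hb⟩, ⟨_, e2, ha⟩⟩
    · exact absurd (by rw [ind_of_notMem ha, ind_of_notMem hb]; decide) h
  exact ⟨mem_closure_iff_nhds.2 fun U h => (hU U h).1,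
    mem_closure_iff_nhds.2 fun U h => (hU U h).2⟩

/-- The boundary chain is not zero: it contains the topmost edge on a vertical line with irrational
abscissa. -/
theorem IsDissection.exists_boundaryChain_ne_zero (hT : IsDissection T R) (i₀ : Fin m) :
    ∃ u w, PrimAdj u w ∧ boundaryChain T s(u, w) ≠ 0 := by
  -- a vertical line with irrational abscissa meets edges at irrational points only
  obtain ⟨x₀, hx₀, hirr⟩ : ∃ x ∈ (T i₀).openTri, Irrational x.1 := by
    have ho : IsOpen (Prod.fst '' (T i₀).openTri) := isOpenMap_fst _ (T i₀).isOpen_openTri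
    obtain ⟨r, hr, hr'⟩ := dense_irrational.exists_mem_open ho ⟨_, _, (T i₀).center_mem, rfl⟩
    obtain ⟨x, hx, rfl⟩ := hr'
    exact ⟨x, hx, hr⟩
  have hRc := hT.isCompact
  have hK : IsCompact (R ∩ Prod.fst ⁻¹' {x₀.1}) :=
    hRc.inter_right (isClosed_singleton.preimage continuous_fst)
  obtain ⟨x, ⟨hxR, hx1⟩, hmax⟩ := hK.exists_isMaxOn
    ⟨x₀, hT.mem_iff.2 ⟨i₀, (T i₀).openTri_subset_carrier hx₀⟩, rfl⟩ continuous_snd.continuousOn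
  have hx1' : x.1 = x₀.1 := hx1
  have habove : ∀ ε : ℝ, 0 < ε → x + ε • ((0, 1) : ℝ × ℝ) ∉ R := by
    intro ε hε hc
    have : (x + ε • ((0, 1) : ℝ × ℝ)).2 ≤ x.2 := hmax ⟨hc, by simp [hx1']⟩
    simp at this
    linarith
  obtain ⟨i, hi⟩ := hT.mem_iff.1 hxR
  have hni : x ∉ (T i).openTri := by
    intro hc
    obtain ⟨ε, h1, h2⟩ := (((tendsto_add_smul x (0, 1) 1).eventually_mem
      ((T i).isOpen_openTri.mem_nhds hc)).and self_mem_nhdsWithin).exists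
    rw [one_mul] at h1
    exact habove ε h2 (hT.mem_iff.2 ⟨i, (T i).openTri_subset_carrier h1⟩)
  obtain ⟨j, hj⟩ := (T i).exists_side hi hni
  obtain ⟨u, w, t, he, ht, h0, h1, rfl, huw⟩ :=
    exists_edgePt_of_irrational ((T i).vertex_ne j) hj (hx1' ▸ hirr)
  have hp := primAdj_of_mem_sideEdges ((T i).vertex_ne j) he
  have htr : Transversal u w (0, 1) := by
    unfold Transversal
    push_cast
    have : (w.1 : ℝ) ≠ u.1 := by exact_mod_cast huw.symm
    simpa [sub_eq_zero] using this
  obtain ⟨ε, ⟨e1, -⟩, e2, e3⟩ := (((T i).count_edges hp htr ht h0 h1).and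
    ((hT.boundaryChain_eq hp htr ht h0 h1).and self_mem_nhdsWithin)).exists
  have hab := habove ε e3
  have hab' : edgePt u w t + ε • ((0, 1) : ℝ × ℝ) ∉ (T i).openTri := fun hc =>
    hab (hT.mem_iff.2 ⟨i, (T i).openTri_subset_carrier hc⟩)
  refine ⟨u, w, hp, ?_⟩
  rw [List.count_eq_one_of_mem (T i).nodup_edges ((T i).mem_edges.2 ⟨j, he⟩)] at e1
  -- the edge is on the boundary of `T i`, which is not above it, so `T i` is below it
  have hbel : edgePt u w t + -ε • ((0, 1) : ℝ × ℝ) ∈ (T i).openTri := by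
    by_contra hc
    rw [ind_of_notMem hab', ind_of_notMem hc] at e1
    exact absurd e1 (by decide)
  have hbel' : edgePt u w t + -ε • ((0, 1) : ℝ × ℝ) ∈ R :=
    hT.mem_iff.2 ⟨i, (T i).openTri_subset_carrier hbel⟩
  rw [e2, ind_of_notMem hab, ind_of_mem hbel']
  decide

end Dissection

/-! ### Colours along lattice segments -/

theorem parity_sidePt_of_even (p q : ℤ × ℤ) {k : ℕ} (hk : Even k) :
    parity (sidePt p q k) = parity p := by
  obtain ⟨l, rfl⟩ := hk
  apply Prod.ext <;> simp [parity, sidePt, CharTwo.add_self_eq_zero]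

theorem parity_sidePt_of_odd (p q : ℤ × ℤ) {k : ℕ} (hk : Odd k) :
    parity (sidePt p q k) = parity (sidePt p q 1) := by
  obtain ⟨l, rfl⟩ := hk
  have h2 : (2 : ZMod 2) = 0 := rfl
  apply Prod.ext <;> simp [parity, sidePt, h2]

theorem parity_sidePt_add_two (p q : ℤ × ℤ) (k : ℕ) :
    parity (sidePt p q (k + 2)) = parity (sidePt p q k) := by
  have h2 : (2 : ZMod 2) = 0 := rfl
  apply Prod.ext <;> simp [parity, sidePt, h2]

theorem even_sideLen {p q : ℤ × ℤ} (h : p ≠ q) (hpq : parity p = parity q) :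
    Even (sideLen p q) := by
  by_contra hodd
  rw [Nat.not_even_iff_odd] at hodd
  have h1 := parity_sidePt_of_odd p q hodd
  rw [sidePt_sideLen, ← hpq] at h1
  simp only [parity, sidePt, Nat.cast_one, one_mul, Int.cast_add, Prod.mk.injEq,
    left_eq_add, ZMod.intCast_zmod_eq_zero_iff_dvd] at h1
  have := (isCoprime_sideDir h).isUnit_of_dvd' h1.1 h1.2
  rw [Int.isUnit_iff] at this
  omega

/-- A triangle of integer area has two vertices of the same colour. -/
theorem LatticeTriangle.exists_parity_eq (t : LatticeTriangle) {k : ℤ} (hk : t.area = k) :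
    ∃ j : Fin 3, parity (t.vertex (j + 1)) = parity (t.vertex (j + 2)) := by
  have hd : t.area = |(t.det : ℝ)| / 2 := by
    rw [area, abs_mul, Matrix.det_fin_three, t.cast_det]
    simp only [Matrix.of_apply, Matrix.cons_val', Matrix.cons_val_zero, Matrix.cons_val_one,
      Matrix.cons_val]
    rw [abs_of_pos (by norm_num : (0 : ℝ) < 1 / 2), mul_comm, mul_one_div]
    congr 2
    ring
  have h2 : |t.det| = 2 * k := by
    have : (|t.det| : ℝ) = 2 * k := by linarith
    exact_mod_cast this
  have h3 : (t.det : ZMod 2) = 0 := by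
    rw [ZMod.intCast_zmod_eq_zero_iff_dvd]
    exact (dvd_abs _ _).1 ⟨k, h2⟩
  simp only [det, Int.cast_sub, Int.cast_mul] at h3
  have key : ∀ a b c d e f : ZMod 2, (c - a) * (f - b) - (d - b) * (e - a) = 0 →
      (c, d) = (e, f) ∨ (e, f) = (a, b) ∨ (a, b) = (c, d) := by decide
  rcases key _ _ _ _ _ _ h3 with h | h | h
  · exact ⟨0, h⟩
  · exact ⟨1, h⟩
  · exact ⟨2, h⟩

/-! ### Classes of edges -/

section Classes

variable {m : ℕ} {T : Fin m → LatticeTriangle} {R : Set (ℝ × ℝ)}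

/-- Two consecutive edges on the boundary of one triangle which are traversed back and forth
between the same two colours. -/
def EdgeRel (T : Fin m → LatticeTriangle) (e e' : Sym2 (ℤ × ℤ)) : Prop :=
  ∃ i u v w, e = s(u, v) ∧ e' = s(v, w) ∧ e ∈ (T i).edges ∧ e' ∈ (T i).edges ∧
    parity u = parity w

/-- Edges up to the equivalence relation generated by `EdgeRel`. -/
abbrev EdgeClass (T : Fin m → LatticeTriangle) := Quot (EdgeRel T)

theorem sum_sideEdges_of_edgeRel {i : Fin m} {p q : ℤ × ℤ}
    (hE : ∀ e ∈ sideEdges p q, e ∈ (T i).edges) {f : Sym2 (ℤ × ℤ) → ZMod 2}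
    (hf : ∀ e e', EdgeRel T e e' → f e = f e') :
    (∀ k < sideLen p q, f (sideEdge p q k) = f (sideEdge p q 0)) ∧
      ((sideEdges p q).map f).sum = (sideLen p q : ZMod 2) * f (sideEdge p q 0) := by
  have h1 : ∀ k < sideLen p q, f (sideEdge p q k) = f (sideEdge p q 0) := by
    intro k hk
    induction k with
    | zero => rfl
    | succ k ih =>
      rw [← ih (by omega)]
      refine (hf _ _ ⟨i, _, _, _, rfl, rfl, hE _ (mem_sideEdges.2 ⟨k, by omega, rfl⟩),
        hE _ (mem_sideEdges.2 ⟨k + 1, hk, rfl⟩), ?_⟩).symm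
      exact (parity_sidePt_add_two p q k).symm
  refine ⟨h1, ?_⟩
  rw [sideEdges, List.map_map, List.map_congr_left (g := fun _ => f (sideEdge p q 0))]
  · simp
  · intro k hk
    exact h1 k (List.mem_range.1 hk)

/-- On the boundary of a triangle with two vertices of the same colour, the related edges cancel:
a side with ends of one colour has an even number of edges, and the two sides with ends of
different colours are related through their common vertex. -/
theorem sum_edges_of_edgeRel {i : Fin m} {j : Fin 3}
    (hj : parity ((T i).vertex (j + 1)) = parity ((T i).vertex (j + 2)))
    {f : Sym2 (ℤ × ℤ) → ZMod 2} (hf : ∀ e e', EdgeRel T e e' → f e = f e') :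
    ((T i).edges.map f).sum = 0 := by
  have hE : ∀ (k : Fin 3), ∀ e ∈ sideEdges ((T i).vertex (k + 1)) ((T i).vertex (k + 2)),
      e ∈ (T i).edges := fun k e he => (T i).mem_edges.2 ⟨k, he⟩
  have hside := fun k : Fin 3 => sum_sideEdges_of_edgeRel (hE k) hf
  have hsum : ((T i).edges.map f).sum = ∑ k : Fin 3,
      ((sideEdges ((T i).vertex (k + 1)) ((T i).vertex (k + 2))).map f).sum := by
    rw [Fin.sum_univ_three]
    simp [LatticeTriangle.edges, add_assoc]
  have heven : ∀ k : Fin 3, parity ((T i).vertex (k + 1)) = parity ((T i).vertex (k + 2)) →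
      ((sideEdges ((T i).vertex (k + 1)) ((T i).vertex (k + 2))).map f).sum = 0 := by
    intro k hk
    rw [(hside k).2, (ZMod.natCast_eq_zero_iff_even).2 (even_sideLen ((T i).vertex_ne k) hk),
      zero_mul]
  have hrot : ∀ g : Fin 3 → ZMod 2, ∑ k, g k = g j + g (j + 1) + g (j + 2) := by
    intro g
    rw [Fin.sum_univ_three]
    fin_cases j
    · rfl
    · change _ = g 1 + g 2 + g 0
      ring
    · change _ = g 2 + g 0 + g 1
      ring
  have e1 : j + 1 + 1 = j + 2 := by fin_cases j <;> rfl
  have e2 : j + 1 + 2 = j := by fin_cases j <;> rfl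
  have e3 : j + 2 + 1 = j := by fin_cases j <;> rfl
  have e4 : j + 2 + 2 = j + 1 := by fin_cases j <;> rfl
  rw [hsum, hrot, heven j hj, zero_add]
  by_cases hc : parity ((T i).vertex (j + 2)) = parity ((T i).vertex j)
  · rw [heven (j + 1) (by rw [e1, e2]; exact hc),
      heven (j + 2) (by rw [e3, e4]; exact (hj.trans hc).symm), add_zero]
  · have hs1 := hside (j + 1)
    have hs2 := hside (j + 2)
    have hE1 := hE (j + 1)
    have hE2 := hE (j + 2)
    have hn1 := (T i).vertex_ne (j + 1)
    have hn2 := (T i).vertex_ne (j + 2)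
    rw [e1, e2] at hs1 hE1 hn1
    rw [e3, e4] at hs2 hE2 hn2
    rw [e1, e2, e3, e4, hs1.2, hs2.2]
    set a := (T i).vertex (j + 2)
    set b := (T i).vertex j
    set c := (T i).vertex (j + 1)
    have ho1 : Odd (sideLen a b) := by
      rw [← Nat.not_even_iff_odd]
      intro he
      have := parity_sidePt_of_even a b he
      rw [sidePt_sideLen] at this
      exact hc this.symm
    have ho2 : Odd (sideLen b c) := by
      rw [← Nat.not_even_iff_odd]
      intro he
      have := parity_sidePt_of_even b c he
      rw [sidePt_sideLen, hj] at this
      exact hc this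
    obtain ⟨l, hl⟩ := ho1
    have hrel : EdgeRel T (sideEdge a b (2 * l)) (sideEdge b c 0) := by
      refine ⟨i, sidePt a b (2 * l), b, sidePt b c 1, ?_, ?_,
        hE1 _ (mem_sideEdges.2 ⟨_, by omega, rfl⟩),
        hE2 _ (mem_sideEdges.2 ⟨_, sideLen_pos hn2, rfl⟩), ?_⟩
      · rw [sideEdge, ← hl, sidePt_sideLen]
      · rw [sideEdge, sidePt_zero]
      · rw [parity_sidePt_of_even a b (even_two_mul l), ← parity_sidePt_of_odd b c ho2,
          sidePt_sideLen]
        exact hj.symm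
    have h1 := hs1.1 (2 * l) (by omega)
    rw [← h1, hf _ _ hrel, (ZMod.natCast_eq_one_iff_odd).2 ho2,
      (ZMod.natCast_eq_one_iff_odd).2 ⟨l, hl⟩, one_mul, CharTwo.add_self_eq_zero]

/-- The two colours at the ends of the edges of a class. -/
def classPair (T : Fin m → LatticeTriangle) : EdgeClass T → Sym2 Color :=
  Quot.lift (fun e => e.map parity) (by
    rintro _ _ ⟨i, u, v, w, rfl, rfl, -, -, h⟩
    simp only [Sym2.map_mk]
    rw [h]
    exact Sym2.eq_swap)

open Classical in
/-- The indicator function of a class of edges. -/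
noncomputable def classInd (T : Fin m → LatticeTriangle) (b : EdgeClass T) (e : Sym2 (ℤ × ℤ)) :
    ZMod 2 :=
  if Quot.mk _ e = b then 1 else 0

/-- A potential of the class `b` takes only one value on the endpoints of another class, because
related edges share a vertex. -/
theorem potential_eq_of_eqvGen {b : EdgeClass T} {s : ℤ × ℤ → ZMod 2}
    (hs : ∀ u v, (edgeGraph T).Adj u v → s v = s u + classInd T b s(u, v))
    {e e' : Sym2 (ℤ × ℤ)} (h : Relation.EqvGen (EdgeRel T) e e') :
    ((∃ i, e ∈ (T i).edges) ↔ (∃ i, e' ∈ (T i).edges)) ∧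
      ((∃ i, e ∈ (T i).edges) → (Quot.mk _ e : EdgeClass T) ≠ b →
        ∀ a ∈ e, ∀ a' ∈ e', s a = s a') := by
  have hsingle : ∀ e : Sym2 (ℤ × ℤ), (∃ i, e ∈ (T i).edges) →
      (Quot.mk _ e : EdgeClass T) ≠ b → ∀ a ∈ e, ∀ a' ∈ e, s a = s a' := by
    rintro e he hb a ⟨c, rfl⟩ a' ha'
    have hac : s a = s c := by
      rw [hs a c he, classInd, if_neg hb, add_zero]
    rcases Sym2.mem_iff.1 ha' with rfl | rfl
    · rfl
    · exact hac
  induction h with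
  | rel x y h =>
    have hq : (Quot.mk _ x : EdgeClass T) = Quot.mk _ y := Quot.sound h
    obtain ⟨i, u, v, w, rfl, rfl, h1, h2, -⟩ := h
    refine ⟨⟨fun _ => ⟨i, h2⟩, fun _ => ⟨i, h1⟩⟩, fun _ hb a ha a' ha' => ?_⟩
    rw [hsingle _ ⟨i, h1⟩ hb a ha v (by simp),
      hsingle _ ⟨i, h2⟩ (hq ▸ hb) a' ha' v (by simp)]
  | refl x => exact ⟨Iff.rfl, hsingle x⟩
  | symm x y h ih =>
    have hq : (Quot.mk _ x : EdgeClass T) = Quot.mk _ y := Quot.eqvGen_sound h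
    exact ⟨ih.1.symm, fun hy hb a ha a' ha' =>
      (ih.2 (ih.1.2 hy) (hq ▸ hb) a' ha' a ha).symm⟩
  | trans x y z h1 h2 ih1 ih2 =>
    have hq : (Quot.mk _ x : EdgeClass T) = Quot.mk _ y := Quot.eqvGen_sound h1
    refine ⟨ih1.1.trans ih2.1, fun hx hb a ha a' ha' => ?_⟩
    induction y using Sym2.ind with
    | _ c d =>
      rw [ih1.2 hx hb a ha c (by simp), ih2.2 (ih1.1.1 hx) (hq ▸ hb) c (by simp) a' ha']

/-- In an integral dissection of a filled set, a closed walk along the edges has a trivial reduced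
colour walk. -/
theorem IsDissection.foldl_push_closed (hT : IsDissection T R) (hR : IsFilled R)
    (hint : ∀ i, ∃ k : ℤ, (T i).area = k) {v : ℤ × ℤ} (p : (edgeGraph T).Walk v v)
    {s : List Color} (hs : IsReduced (parity v :: s)) :
    (p.support.tail.map parity).foldl push (parity v :: s) = parity v :: s := by
  have hpot : ∀ b : EdgeClass T, ∃ σ : ℤ × ℤ → ZMod 2,
      ∀ u v, (edgeGraph T).Adj u v → σ v = σ u + classInd T b s(u, v) := by
    intro b
    refine exists_potential _ _ fun u w => hT.sum_edges_eq_zero hR _ (fun i => ?_) w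
    obtain ⟨k, hk⟩ := hint i
    obtain ⟨j, hj⟩ := (T i).exists_parity_eq hk
    refine sum_edges_of_edgeRel hj fun e e' he => ?_
    rw [classInd, classInd, Quot.sound he]
  choose σ hσ using hpot
  let κ : EdgeClass T → EdgeClass T → ZMod 2 := fun c b => σ b (Quot.out c).out.1
  have hκ : ∀ u w, (edgeGraph T).Adj u w → ∀ b, b ≠ Quot.mk _ s(u, w) →
      σ b u = κ (Quot.mk _ s(u, w)) b := by
    intro u w huw b hb
    have he : Relation.EqvGen (EdgeRel T) s(u, w)
        (Quot.out (Quot.mk (EdgeRel T) s(u, w))) := by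
      rw [← Quot.eq, Quot.out_eq]
    exact (potential_eq_of_eqvGen (hσ b) he).2 huw hb.symm u (by simp) _ (Sym2.out_fst_mem _)
  have hwalk : ∀ {u v : ℤ × ℤ} (p : (edgeGraph T).Walk u v),
      IsBridgeWalk κ (classPair T) (fun b => σ b u) (parity u)
        (p.darts.map fun d => (Quot.mk _ d.edge, parity d.snd)) (fun b => σ b v) := by
    intro u v p
    induction p with
    | nil => exact rfl
    | @cons u w v h p ih =>
      refine ⟨rfl, hκ u w h, fun b => σ b w, ?_, fun b hb => ?_, ih⟩
      · change σ _ w = σ _ u + 1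
        rw [hσ _ u w h, classInd]
        exact congrArg _ (if_pos rfl)
      · change σ b w = σ b u
        have hb' : (Quot.mk _ s(u, w) : EdgeClass T) ≠ b := Ne.symm hb
        rw [hσ b u w h, classInd, if_neg hb', add_zero]
  have := (hwalk p).foldl_push hs
  rw [List.map_map] at this
  rw [← p.map_snd_darts, List.map_map]
  exact this

/-- Walking along a lattice segment, the reduced colour walk only sees the endpoint, as the two
colours of the segment alternate. -/
theorem exists_walk_sideEdges {p q : ℤ × ℤ} (h : ∀ e ∈ sideEdges p q, e ∈ allEdges T) :
    ∃ w : (edgeGraph T).Walk p q, ∀ s : List Color, IsReduced (parity p :: s) →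
      (w.support.tail.map parity).foldl push (parity p :: s) =
        push (parity p :: s) (parity q) := by
  have key : ∀ k ≤ sideLen p q, ∃ w : (edgeGraph T).Walk p (sidePt p q k),
      ∀ s : List Color, IsReduced (parity p :: s) →
      (w.support.tail.map parity).foldl push (parity p :: s) =
        push (parity p :: s) (parity (sidePt p q k)) := by
    intro k hk
    induction k with
    | zero =>
      rw [sidePt_zero]
      exact ⟨SimpleGraph.Walk.nil, fun s _ => by simp [push_self]⟩
    | succ k ih =>
      obtain ⟨w, hw⟩ := ih (by omega)
      have hadj : (edgeGraph T).Adj (sidePt p q k) (sidePt p q (k + 1)) :=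
        mem_allEdges.1 (h _ (mem_sideEdges.2 ⟨k, by omega, rfl⟩))
      refine ⟨w.concat hadj, fun s hs => ?_⟩
      have ht : (w.concat hadj).support.tail = w.support.tail ++ [sidePt p q (k + 1)] := by
        rw [SimpleGraph.Walk.support_concat, List.tail_append_of_ne_nil w.support_ne_nil]
      rw [ht, List.map_append, List.foldl_append, hw s hs]
      simp only [List.map_cons, List.map_nil, List.foldl_cons, List.foldl_nil]
      rcases Nat.even_or_odd k with hk' | hk'
      · rw [parity_sidePt_of_even p q hk', push_self]
      · rw [parity_sidePt_of_even p q hk'.add_one, push_push_back hs, push_self]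
  obtain ⟨w, hw⟩ := key _ le_rfl
  exact ⟨w.copy rfl (sidePt_sideLen p q), fun s hs => by
    simpa [sidePt_sideLen] using hw s hs⟩

end Classes

/-! ### Simple lattice polygons -/

section Polygons

variable {n : ℕ}

theorem edgeSet_realize (P : Polygon (ℤ × ℤ) n) (i : Fin n) :
    (realize P).edgeSet ℝ i = segment ℝ (toPlane (P i)) (toPlane (P (finRotate n i))) :=
  affineSegment_eq_segment ..

theorem isClosed_boundary (P : Polygon (ℤ × ℤ) n) : IsClosed ((realize P).boundary ℝ) := by
  refine isClosed_iUnion_of_finite fun i => ?_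
  rw [edgeSet_realize, segment_eq_image_lineMap]
  exact (isCompact_Icc.image AffineMap.lineMap_continuous).isClosed

theorem isFilled_region (Q : Polygon (ℝ × ℝ) n) : IsFilled (region Q) := by
  intro x hx
  simp only [region, Set.mem_union, Set.mem_ofPred_eq, not_or, not_and] at hx
  refine ⟨connectedComponentIn (Q.boundary ℝ)ᶜ x, isPreconnected_connectedComponentIn,
    mem_connectedComponentIn hx.1, fun y hy hyR => ?_, hx.2 hx.1⟩
  have hyb := connectedComponentIn_subset _ _ hy
  rcases hyR with h | ⟨-, h⟩
  · exact hyb h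
  · rw [← connectedComponentIn_eq hy] at h
    exact hx.2 hx.1 h

theorem frontier_region_subset (P : Polygon (ℤ × ℤ) n) (hc : IsClosed (region (realize P))) :
    frontier (region (realize P)) ⊆ (realize P).boundary ℝ := by
  intro x hx
  by_contra hb
  rw [hc.frontier_eq] at hx
  refine hx.2 (mem_interior.2 ⟨connectedComponentIn ((realize P).boundary ℝ)ᶜ x, ?_,
    (isClosed_boundary P).isOpen_compl.connectedComponentIn, mem_connectedComponentIn hb⟩)
  rcases hx.1 with h | ⟨-, h⟩
  · exact absurd h hb
  · intro y hy
    refine Or.inr ⟨connectedComponentIn_subset _ _ hy, ?_⟩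
    rwa [← connectedComponentIn_eq hy]

variable {P : Polygon (ℤ × ℤ) n}

theorem IsSimple.vertex_injective (hP : IsSimple (realize P)) : Function.Injective P.vertices :=
  fun _ _ h => hP.2.1 (congrArg toPlane h)

theorem IsSimple.finRotate_ne (hP : IsSimple (realize P)) (i : Fin n) : finRotate n i ≠ i := by
  obtain ⟨N, rfl⟩ : ∃ N, n = N + 3 := ⟨n - 3, by have := hP.1; omega⟩
  rw [finRotate_apply]
  simp

theorem IsSimple.finRotate_finRotate_ne (hP : IsSimple (realize P)) (i : Fin n) :
    finRotate n (finRotate n i) ≠ i := by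
  obtain ⟨N, rfl⟩ : ∃ N, n = N + 3 := ⟨n - 3, by have := hP.1; omega⟩
  rw [finRotate_apply, finRotate_apply, add_assoc]
  intro h
  have h2 : (1 + 1 : Fin (N + 3)) = 0 := by simpa using h
  have := congrArg Fin.val h2
  rw [Fin.val_add, Fin.val_one, Nat.mod_eq_of_lt (by omega)] at this
  simp at this

theorem IsSimple.ne (hP : IsSimple (realize P)) (i : Fin n) : P i ≠ P (finRotate n i) :=
  fun h => hP.finRotate_ne i (hP.vertex_injective h).symm

/-- The lattice points on the boundary of a simple polygon are distinct. -/
theorem IsSimple.sidePt_injective (hP : IsSimple (realize P)) {i j : Fin n} {k l : ℕ}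
    (hk : k < sideLen (P i) (P (finRotate n i))) (hl : l < sideLen (P j) (P (finRotate n j)))
    (h : sidePt (P i) (P (finRotate n i)) k = sidePt (P j) (P (finRotate n j)) l) :
    i = j ∧ k = l := by
  by_cases hij : i = j
  · subst hij
    exact ⟨rfl, LatticeDissection.sidePt_injective (hP.ne i) h⟩
  · exfalso
    have hi := toPlane_sidePt_mem (hP.ne i) hk.le
    have hj := toPlane_sidePt_mem (hP.ne j) hl.le
    rw [← h] at hj
    rw [← edgeSet_realize] at hi hj
    obtain ⟨h1, h2⟩ := hP.2.2 i j hij ⟨hi, hj⟩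
    have key : ∀ i : Fin n, ∀ k < sideLen (P i) (P (finRotate n i)),
        toPlane (sidePt (P i) (P (finRotate n i)) k) ∈
          ({(realize P) i, (realize P) (finRotate n i)} : Set (ℝ × ℝ)) →
        sidePt (P i) (P (finRotate n i)) k = P i := by
      rintro i k hk (h | h)
      · exact toPlane_injective h
      · have h3 : sidePt (P i) (P (finRotate n i)) k = P (finRotate n i) := toPlane_injective h
        rw [← sidePt_sideLen (P i) (P (finRotate n i))] at h3
        simp only [sidePt_sideLen] at h3
        have h4 := sidePt_sideLen (P i) (P (finRotate n i))
        have := LatticeDissection.sidePt_injective (hP.ne i) (h3.trans h4.symm)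
        omega
    have e1 := key i k hk h1
    rw [h] at h2
    have e2 := key j l hl h2
    rw [h, e2] at e1
    exact hij (hP.vertex_injective e1).symm

/-- Only two boundary edges of a simple polygon meet at a lattice point of the boundary. -/
theorem IsSimple.eq_of_mem_sideEdge (hP : IsSimple (realize P)) {i j : Fin n} {k l : ℕ}
    (hk : k < sideLen (P i) (P (finRotate n i))) (hl : l < sideLen (P j) (P (finRotate n j)))
    (h : sidePt (P i) (P (finRotate n i)) k ∈ sideEdge (P j) (P (finRotate n j)) l) :
    (j = i ∧ l = k) ∨ (j = i ∧ l + 1 = k) ∨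
      (finRotate n j = i ∧ k = 0 ∧ l + 1 = sideLen (P j) (P (finRotate n j))) := by
  rcases Sym2.mem_iff.1 h with h | h
  · obtain ⟨rfl, rfl⟩ := hP.sidePt_injective hk hl h
    exact Or.inl ⟨rfl, rfl⟩
  · by_cases hl' : l + 1 < sideLen (P j) (P (finRotate n j))
    · obtain ⟨rfl, rfl⟩ := hP.sidePt_injective hk hl' h
      exact Or.inr (Or.inl ⟨rfl, rfl⟩)
    · have hl'' : l + 1 = sideLen (P j) (P (finRotate n j)) := by omega
      rw [hl'', sidePt_sideLen,
        ← sidePt_zero (P (finRotate n j)) (P (finRotate n (finRotate n j)))] at h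
      obtain ⟨rfl, rfl⟩ := hP.sidePt_injective hk (sideLen_pos (hP.ne _)) h
      exact Or.inr (Or.inr ⟨rfl, rfl, hl''⟩)

theorem not_isDiag_sideEdge {p q : ℤ × ℤ} (h : p ≠ q) (k : ℕ) : ¬ (sideEdge p q k).IsDiag := by
  rw [sideEdge, Sym2.mk_isDiag_iff]
  exact (primAdj_sidePt h k).ne

theorem IsSimple.sideEdge_ne (hP : IsSimple (realize P)) {i j : Fin n} {k l : ℕ}
    (hk : k < sideLen (P i) (P (finRotate n i))) (hl : l < sideLen (P j) (P (finRotate n j)))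
    (hij : j ≠ i) (hr : finRotate n j = i) :
    sideEdge (P i) (P (finRotate n i)) k ≠ sideEdge (P j) (P (finRotate n j)) l := by
  intro h
  have h1 : sidePt (P j) (P (finRotate n j)) l ∈ sideEdge (P i) (P (finRotate n i)) k := by
    rw [h]; simp [sideEdge]
  rcases hP.eq_of_mem_sideEdge hl hk h1 with ⟨h2, -⟩ | ⟨h2, -⟩ | ⟨h2, -⟩
  · exact hij h2.symm
  · exact hij h2.symm
  · rw [← hr] at h2
    exact hP.finRotate_finRotate_ne j h2

variable {m : ℕ} {T : Fin m → LatticeTriangle}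

/-- The boundary chain of a dissection of a simple polygon is supported on its sides. -/
theorem exists_sideEdge_of_boundaryChain (hP : IsSimple (realize P))
    (hT : IsDissection T (region (realize P))) {e : Sym2 (ℤ × ℤ)} (he : boundaryChain T e ≠ 0) :
    ∃ j, ∃ l < sideLen (P j) (P (finRotate n j)), sideEdge (P j) (P (finRotate n j)) l = e := by
  have hmem : e ∈ allEdges T := by_contra fun hc => he (boundaryChain_eq_zero hc)
  induction e using Sym2.ind with
  | _ u w =>
    have hp := primAdj_of_mem_allEdges hmem
    have hfr := frontier_region_subset P hT.isCompact.isClosed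
      (hT.mem_frontier hp he irrational_sqrt_two_sub_one sqrt_two_sub_one_pos
        sqrt_two_sub_one_lt)
    obtain ⟨j, hj⟩ := Set.mem_iUnion.1 hfr
    rw [edgeSet_realize, edgePt_mem_segment_iff hp (hP.ne j) irrational_sqrt_two_sub_one
      sqrt_two_sub_one_pos sqrt_two_sub_one_lt] at hj
    exact ⟨j, mem_sideEdges.1 hj⟩

theorem boundaryChain_succ (hP : IsSimple (realize P))
    (hT : IsDissection T (region (realize P))) {i : Fin n} {k : ℕ}
    (hk : k + 1 < sideLen (P i) (P (finRotate n i))) :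
    boundaryChain T (sideEdge (P i) (P (finRotate n i)) (k + 1)) =
      boundaryChain T (sideEdge (P i) (P (finRotate n i)) k) := by
  refine boundaryChain_eq_of_vertex (v := sidePt (P i) (P (finRotate n i)) (k + 1))
    (fun h => by have := sideEdge_injective (hP.ne i) h; omega) (by simp [sideEdge])
    (by simp [sideEdge]) (not_isDiag_sideEdge (hP.ne i) _) (not_isDiag_sideEdge (hP.ne i) _) ?_
  intro e hv he
  obtain ⟨j, l, hl, rfl⟩ := exists_sideEdge_of_boundaryChain hP hT he
  rcases hP.eq_of_mem_sideEdge hk hl hv with ⟨rfl, rfl⟩ | ⟨rfl, h⟩ | ⟨-, h, -⟩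
  · exact Or.inl rfl
  · obtain rfl : l = k := by omega
    exact Or.inr rfl
  · omega

theorem boundaryChain_finRotate (hP : IsSimple (realize P))
    (hT : IsDissection T (region (realize P))) (i : Fin n) {k : ℕ}
    (hk : k + 1 = sideLen (P i) (P (finRotate n i))) :
    boundaryChain T (sideEdge (P (finRotate n i)) (P (finRotate n (finRotate n i))) 0) =
      boundaryChain T (sideEdge (P i) (P (finRotate n i)) k) := by
  have h0 := sideLen_pos (hP.ne (finRotate n i))
  refine boundaryChain_eq_of_vertex (v := P (finRotate n i))
    (hP.sideEdge_ne h0 (by omega) (hP.finRotate_ne i).symm rfl) (by simp [sideEdge, sidePt_zero])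
    (by simp [sideEdge, hk, sidePt_sideLen]) (not_isDiag_sideEdge (hP.ne _) _)
    (not_isDiag_sideEdge (hP.ne i) _) ?_
  intro e hv he
  obtain ⟨j, l, hl, rfl⟩ := exists_sideEdge_of_boundaryChain hP hT he
  rw [← sidePt_zero (P (finRotate n i)) (P (finRotate n (finRotate n i)))] at hv
  rcases hP.eq_of_mem_sideEdge h0 hl hv with ⟨rfl, rfl⟩ | ⟨-, h⟩ | ⟨h, -, h'⟩
  · exact Or.inl rfl
  · omega
  · obtain rfl := (finRotate n).injective h
    obtain rfl : l = k := by omega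
    exact Or.inr rfl

/-- All boundary edges of a simple polygon are edges of triangles of each dissection: the boundary
chain is a nonzero cycle supported on a simple closed curve, so it is the whole curve. -/
theorem sideEdges_subset_allEdges (hP : IsSimple (realize P))
    (hT : IsDissection T (region (realize P))) (i : Fin n) :
    ∀ e ∈ sideEdges (P i) (P (finRotate n i)), e ∈ allEdges T := by
  obtain ⟨N, rfl⟩ : ∃ N, n = N + 1 := ⟨n - 1, by have := hP.1; omega⟩
  have hside : ∀ (i : Fin (N + 1)) (k : ℕ), k < sideLen (P i) (P (finRotate _ i)) →
      boundaryChain T (sideEdge (P i) (P (finRotate _ i)) k) =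
        boundaryChain T (sideEdge (P i) (P (finRotate _ i)) 0) := by
    intro i k hk
    induction k with
    | zero => rfl
    | succ k ih => rw [boundaryChain_succ hP hT hk, ih (by omega)]
  have hall : ∀ i : Fin (N + 1), boundaryChain T (sideEdge (P i) (P (finRotate _ i)) 0) =
      boundaryChain T (sideEdge (P 0) (P (finRotate _ 0)) 0) := by
    intro i
    induction i using Fin.induction with
    | zero => rfl
    | succ i ih =>
      rw [← ih]
      have hpos := sideLen_pos (hP.ne i.castSucc)
      have h := boundaryChain_finRotate hP hT i.castSucc
        (k := sideLen (P i.castSucc) (P (finRotate _ i.castSucc)) - 1) (by omega)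
      rw [hside i.castSucc _ (by omega)] at h
      have hr : finRotate (N + 1) i.castSucc = i.succ := by
        rw [finRotate_apply, Fin.coeSucc_eq_succ]
      rw [← h, hr]
  have hi₀ : ∃ i₀ : Fin m, toPlane (P 0) ∈ (T i₀).carrier := by
    rw [← hT.mem_iff]
    refine Or.inl (Set.mem_iUnion.2 ⟨0, ?_⟩)
    rw [edgeSet_realize]
    exact left_mem_segment ℝ _ _
  obtain ⟨i₀, -⟩ := hi₀
  obtain ⟨u, w, -, hne⟩ := hT.exists_boundaryChain_ne_zero i₀
  obtain ⟨j, l, hl, hj⟩ := exists_sideEdge_of_boundaryChain hP hT hne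
  rw [← hj, hside j l hl, hall j] at hne
  intro e he
  obtain ⟨k, hk, rfl⟩ := mem_sideEdges.1 he
  by_contra hc
  apply hne
  rw [← hall i, ← hside i k hk, boundaryChain_eq_zero hc]

/-- The boundary word of a simple polygon with an integral dissection is contractible. -/
theorem contractible_boundaryWord (hP : IsSimple (realize P))
    (hD : HasIntegralDissection (region (realize P))) : Contractible (boundaryWord P) := by
  obtain ⟨m, T, hT, hint⟩ := hD
  obtain ⟨N, rfl⟩ : ∃ N, n = N + 1 := ⟨n - 1, by have := hP.1; omega⟩
  -- the vertices, indexed periodically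
  set v : ℕ → ℤ × ℤ := fun j => P (Fin.ofNat (N + 1) j) with hv
  have hnext : ∀ j, P (finRotate (N + 1) (Fin.ofNat (N + 1) j)) = v (j + 1) := by
    intro j
    rw [finRotate_apply, hv]
    congr 1
    apply Fin.ext
    simp [Fin.val_add]
  have hwalk : ∀ j, ∃ w : (edgeGraph T).Walk (v 0) (v j),
      (w.support.tail.map parity).foldl push [parity (v 0)] =
        ((List.range j).map fun i => parity (v (i + 1))).foldl push [parity (v 0)] := by
    intro j
    induction j with
    | zero => exact ⟨SimpleGraph.Walk.nil, rfl⟩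
    | succ j ih =>
      obtain ⟨w, hw⟩ := ih
      have hE := sideEdges_subset_allEdges hP hT (Fin.ofNat (N + 1) j)
      rw [hnext] at hE
      obtain ⟨w', hw'⟩ := exists_walk_sideEdges hE
      refine ⟨w.append w', ?_⟩
      have hred : IsReduced ((w.support.tail.map parity).foldl push [parity (v 0)]) :=
        IsReduced.foldl (s := [parity (v 0)]) trivial _
      have hgl : (w.support.tail.map parity).getLast?.getD (parity (v 0)) = parity (v j) := by
        have h1 := w.getLast_support
        have h2 : w.support.map parity = parity (v 0) :: w.support.tail.map parity := by
          rw [← List.map_cons, SimpleGraph.Walk.cons_tail_support]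
        have h3 : (w.support.map parity).getLast? = some (parity (v j)) := by
          rw [List.getLast?_map, List.getLast?_eq_some_getLast w.support_ne_nil, h1]
          rfl
        rw [h2, List.getLast?_cons] at h3
        simpa using h3
      obtain ⟨t, ht⟩ :=
        exists_foldl_push_eq_cons (parity (v 0)) [] (w.support.tail.map parity)
      rw [hgl] at ht
      rw [ht] at hred
      rw [SimpleGraph.Walk.tail_support_append, List.map_append, List.foldl_append, ht,
        hw' t hred, ← ht, hw, List.range_succ, List.map_append, List.foldl_append]
      rfl
  obtain ⟨w, hw⟩ := hwalk (N + 1)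
  have hclosed : v (N + 1) = v 0 := by
    simp only [hv]
    congr 1
    apply Fin.ext
    simp
  have hfold := hT.foldl_push_closed (isFilled_region _) hint (w.copy rfl hclosed) (s := [])
    trivial
  rw [SimpleGraph.Walk.support_copy, hw, List.range_succ, List.map_append] at hfold
  simp only [List.map_cons, List.map_nil, hclosed] at hfold
  have := contractible_of_foldl_push (parity (v 0))
    ((List.range N).map fun i => parity (v (i + 1))) [] hfold
  have hword : (List.ofFn fun i => parity (P i)) =
      parity (v 0) :: (List.range N).map fun i => parity (v (i + 1)) := by
    have h1 : (List.ofFn fun i => parity (P i)) =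
        (List.range (N + 1)).map fun i => parity (v i) := by
      rw [← List.map_coe_finRange_eq_range, List.map_map, List.ofFn_eq_map]
      refine List.map_congr_left fun i _ => ?_
      simp [hv]
    rw [h1, List.range_succ_eq_map, List.map_cons, List.map_map]
    rfl
  rw [boundaryWord, hword]
  simpa using this

end Polygons

end LatticeDissection

theorem theorem9p1 {n : ℕ} (P : Polygon (ℤ × ℤ) n)
    (hP : LatticeDissection.IsSimple (LatticeDissection.realize P))
    (hw : ¬ LatticeDissection.Contractible (LatticeDissection.boundaryWord P)) :
    ¬ LatticeDissection.HasIntegralDissection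
        (LatticeDissection.region (LatticeDissection.realize P)) :=
  fun h => hw (LatticeDissection.contractible_boundaryWord hP h)
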